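/- Let $(X,L)$ be a finite simplicial pair that triangulates a rational homology $n$-manifold $X$ with boundary $L$, i.e. the link of each $k$-simplex of $X$ has the reduced rational homology of $S^{n-k-1}$ if the simplex is not in $L$, and of a point if it is in $L$. Let $X$ be oriented by a fundamental cycle $z=\sum_{\sigma}\varepsilon_\sigma\,\sigma$ (sum over the $n$-simplices of $X$, $\varepsilon_\sigma=\pm1$, $\partial z$ supported in $L$), where simplices are oriented by a chosen local ordering of the vertices of $X$. Let $\overline X\to X$ be a normal simplicial covering with group $\Gamma$ and let $\widetilde X\to X$ be a normal covering with group $\pi$ that factors through $\overline X$, with $\pi\to\Gamma$ surjective (for connected $X$ and $\overline X$, e.g. the universal covering and $\pi=\pi_1(X)$); let $\overline L,\widetilde L$ be the preimages of $L$ and lift the local ordering to $\overline X$ and $\widetilde X$. Put $$C^p_{(2)}(\overline X,\overline L)=\operatorname{Hom}_{\mathbb Z\pi}(C_p(\widetilde X,\widetilde L),l^2(\Gamma)),\qquad C_q^{(2)}(\overline X,\overline L)=l^2(\Gamma)\otimes_{\mathbb Z\pi}C_q(\widetilde X,\widetilde L).$$ Identify both with the square-summable functions on the simplices of $\overline X$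 not in $\overline L$ of the given dimension, through $\alpha\mapsto\sum_{\overline\sigma}\langle 1,\alpha(\widetilde\sigma)\rangle\,\overline\sigma$ (inner product linear in the first variable, $\widetilde\sigma$ a lift of $\overline\sigma$) and $(\sum_g\lambda_g g)\otimes\widetilde\sigma\mapsto\sum_g\lambda_g\,g\overline\sigma$ ($\overline\sigma$ the image of $\widetilde\sigma$). For $p+q=n$ let $g_{\overline X}$ be the map from functions on $p$-simplices to functions on $q$-simplices that corresponds to the composition of the cap product with the fundamental cycle, $$C^p_{(2)}(\overline X,\overline L)\to C_q^{(2)}(\overline X),\qquad \alpha\mapsto\sum_{\sigma}\varepsilon_\sigma\,\alpha(b_p(\widetilde\sigma))^*\otimes f_q(\widetilde\sigma),$$ with the map $C_q^{(2)}(\overline X)\to C_q^{(2)}(\overline X,\overline L)$ induced by inclusion. Here $\sigma$ runs through the $n$-simplices of $X$, $f_q$ and $b_p$ are the front $q$-face and the back $p$-face, and $(\sum_g\lambda_g g)^*=\sum_g\overline{\lambda_g}\,g^{-1}$. Let $U$ be a finite subcomplex of $\overline X$ with a subcomplex $V$ (not necessarily contained in $\overline L$) such that $(U,V)$ triangulates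 a rational homology $n$-manifold with boundary $V$, oriented compatibly with $\overline X$: each $n$-simplex of $U$ has the same coefficient in the fundamental cycle of $(U,V)$ as its image in $X$ has in $z$. Let $g_U$ be the map defined in the same way for $(U,V)$ and the trivial covering, with the restricted local ordering. Let $P_U^*$ be the extension by zero of functions on the simplices of $U$ not in $V$ to functions on the simplices of $\overline X$ not in $\overline L$, and let $P_U$ be its adjoint. Then for all $p+q=n$ the map $P_U^*$ is an isometric embedding in degrees $p$ and $q$, and on functions on $p$-simplices $$g_U=P_U\circ g_{\overline X}\circ P_U^*.$$ -/

import Mathlib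

noncomputable section

open scoped Classical TensorProduct ComplexConjugate

/-! ### Simplicial complexes, links, rational homology manifolds

A simplicial complex with vertices in a type `A` is a `PreAbstractSimplicialComplex A`
(elements of `A` that are not in any face are not vertices of the complex). -/

/-- The `p`-simplices of `K` that do not belong to `L`; `L = ⊥` gives all `p`-simplices of `K`. -/
abbrev Simplex {A : Type*} (K L : PreAbstractSimplicialComplex A) (p : ℕ) : Type _ :=
  {s : Finset A // s ∈ K.faces ∧ s.card = p + 1 ∧ s ∉ L.faces}

/-- The link of a simplex `s` of `K`: the complex of all `t` disjoint from `s` with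
`s ∪ t ∈ K`. -/
def simplicialLink {A : Type*} (K : PreAbstractSimplicialComplex A) (s : Finset A) :
    PreAbstractSimplicialComplex A where
  faces := {t | t.Nonempty ∧ Disjoint s t ∧ s ∪ t ∈ K.faces}
  isRelLowerSet_faces := by
    rintro t ⟨h1, h2, h3⟩
    refine ⟨h1, fun u hu hne => ⟨hne, h2.mono_right hu, ?_⟩⟩
    exact (K.isRelLowerSet_faces h3).2 (Finset.union_subset_union_right hu)
      (hne.mono Finset.subset_union_right)

/-- The ordered simplicial chains of `K` with `m` vertices (i.e. of degree `m - 1`), with rational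
coefficients: finite combinations of `m`-tuples of vertices (repetitions allowed) that lie in a
common simplex. For `m = 0` there is just the empty tuple, which gives the augmentation. -/
def orderedChains {A : Type*} (K : PreAbstractSimplicialComplex A) (m : ℕ) :
    Submodule ℚ ((Fin m → A) →₀ ℚ) :=
  Finsupp.supported ℚ ℚ {t | m = 0 ∨ Finset.univ.image t ∈ K.faces}

/-- The boundary `(v₀, …, vₘ) ↦ ∑ᵢ (-1)ⁱ (v₀, …, v̂ᵢ, …, vₘ)`. -/
def orderedBoundary (A : Type*) (m : ℕ) :
    ((Fin (m + 1) → A) →₀ ℚ) →ₗ[ℚ] ((Fin m → A) →₀ ℚ) :=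
  Finsupp.linearCombination ℚ fun t =>
    ∑ i : Fin (m + 1), Finsupp.single (fun j => t (i.succAbove j)) ((-1 : ℚ) ^ (i : ℕ))

/-- The cycles of the augmented ordered chain complex. -/
def orderedCycles {A : Type*} (K : PreAbstractSimplicialComplex A) :
    (m : ℕ) → Submodule ℚ ((Fin m → A) →₀ ℚ)
  | 0 => orderedChains K 0
  | m + 1 => orderedChains K (m + 1) ⊓ LinearMap.ker (orderedBoundary A m)

/-- The boundaries of the augmented ordered chain complex. -/
def orderedBoundaries {A : Type*} (K : PreAbstractSimplicialComplex A) (m : ℕ) :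
    Submodule ℚ ((Fin m → A) →₀ ℚ) :=
  (orderedChains K (m + 1)).map (orderedBoundary A m)

/-- The reduced rational homology of `K` in degree `m - 1`. -/
abbrev reducedHomology {A : Type*} (K : PreAbstractSimplicialComplex A) (m : ℕ) : Type _ :=
  ↥(orderedCycles K m) ⧸ (orderedBoundaries K m).submoduleOf (orderedCycles K m)

/-- `K` has the reduced rational homology of a sphere of dimension `d - 1`
(for `d = 0`: of the empty set). -/
def HasSphereHomology {A : Type*} (K : PreAbstractSimplicialComplex A) (d : ℕ) : Prop :=
  Nonempty (reducedHomology K d ≃ₗ[ℚ] ℚ) ∧ ∀ m, m ≠ d → Subsingleton (reducedHomology K m)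

/-- `K` has the reduced rational homology of a point. -/
def HasPointHomology {A : Type*} (K : PreAbstractSimplicialComplex A) : Prop :=
  ∀ m, Subsingleton (reducedHomology K m)

/-- `(K, L)` triangulates a rational homology `n`-manifold with boundary `L`: the link of a
`k`-simplex of `K` has the rational homology of the sphere of dimension `n - k - 1` if the simplex
does not belong to `L`, and that of a point if it does. Equivalently, the local homology at a point
`x` is that of `ℝⁿ` at an interior point if `x ∉ L`, and that of a half space at a boundary point
if `x ∈ L`. -/
structure IsRatHomologyManifold {A : Type*} (K L : PreAbstractSimplicialComplex A) (n : ℕ) :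
    Prop where
  le : L ≤ K
  interior : ∀ s ∈ K.faces, s ∉ L.faces →
    ∃ d, d + s.card = n + 1 ∧ HasSphereHomology (simplicialLink K s) d
  boundary : ∀ s ∈ L.faces, HasPointHomology (simplicialLink K s)

/-! ### Simplicial maps, local orderings, fundamental cycles -/

/-- `f` maps the simplices of `K` to simplices of `K'` of the same dimension. -/
def IsNondegenerate {A B : Type*} (f : A → B) (K : PreAbstractSimplicialComplex A)
    (K' : PreAbstractSimplicialComplex B) : Prop :=
  ∀ s ∈ K.faces, s.image f ∈ K'.faces ∧ Set.InjOn f s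

/-- The map induced by a nondegenerate simplicial map on simplices. -/
def Simplex.map {A B : Type*} {K L : PreAbstractSimplicialComplex A}
    {K' L' : PreAbstractSimplicialComplex B} {p : ℕ} (f : A → B) (hf : IsNondegenerate f K K')
    (hL : ∀ s ∈ K.faces, s.image f ∈ L'.faces → s ∈ L.faces) (s : Simplex K L p) :
    Simplex K' L' p :=
  ⟨s.1.image f, (hf s.1 s.2.1).1, by
    rw [Finset.card_image_of_injOn (hf s.1 s.2.1).2]; exact s.2.2.1,
    fun h => s.2.2.2 (hL s.1 s.2.1 h)⟩

/-- A local ordering of the vertices of `K`: a relation that restricts to a strict total order on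
the vertices of each simplex. -/
structure LocalOrder {A : Type*} (K : PreAbstractSimplicialComplex A) where
  lt : A → A → Prop
  irrefl : ∀ s ∈ K.faces, ∀ a ∈ s, ¬ lt a a
  trans : ∀ s ∈ K.faces, ∀ a ∈ s, ∀ b ∈ s, ∀ c ∈ s, lt a b → lt b c → lt a c
  total : ∀ s ∈ K.faces, ∀ a ∈ s, ∀ b ∈ s, a ≠ b → lt a b ∨ lt b a

/-- The local ordering pulled back along a nondegenerate simplicial map. -/
def LocalOrder.comap {A B : Type*} {K : PreAbstractSimplicialComplex A}
    {K' : PreAbstractSimplicialComplex B} (o : LocalOrder K') (f : A → B)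
    (hf : IsNondegenerate f K K') : LocalOrder K where
  lt a b := o.lt (f a) (f b)
  irrefl s hs a ha := o.irrefl _ (hf s hs).1 _ (Finset.mem_image_of_mem f ha)
  trans s hs a ha b hb c hc := o.trans _ (hf s hs).1 _ (Finset.mem_image_of_mem f ha)
    _ (Finset.mem_image_of_mem f hb) _ (Finset.mem_image_of_mem f hc)
  total s hs a ha b hb hab := o.total _ (hf s hs).1 _ (Finset.mem_image_of_mem f ha)
    _ (Finset.mem_image_of_mem f hb) fun h => hab ((hf s hs).2 ha hb h)

/-- The elements of `s` with at most `q` predecessors in `s`. -/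
def initialPart {A : Type*} (lt : A → A → Prop) (s : Finset A) (q : ℕ) : Finset A :=
  s.filter fun v => (s.filter fun w => lt w v).card ≤ q

theorem card_initialPart {A : Type*} (lt : A → A → Prop) (s : Finset A) (q : ℕ)
    (hi : ∀ a ∈ s, ¬ lt a a)
    (ht : ∀ a ∈ s, ∀ b ∈ s, ∀ c ∈ s, lt a b → lt b c → lt a c)
    (hl : ∀ a ∈ s, ∀ b ∈ s, a ≠ b → lt a b ∨ lt b a) (hq : q + 1 ≤ s.card) :
    (initialPart lt s q).card = q + 1 := by
  set rk : A → ℕ := fun v => (s.filter fun w => lt w v).card with hrk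
  have hmono : ∀ a ∈ s, ∀ b ∈ s, lt a b → rk a < rk b := by
    intro a ha b hb hab
    refine Finset.card_lt_card ⟨fun w hw => ?_, fun hsub => ?_⟩
    · simp only [Finset.mem_filter] at hw ⊢
      exact ⟨hw.1, ht w hw.1 a ha b hb hw.2 hab⟩
    · have := hsub (Finset.mem_filter.2 ⟨ha, hab⟩)
      exact hi a ha (Finset.mem_filter.1 this).2
  have hinj : Set.InjOn rk s := by
    intro a ha b hb hab
    by_contra hne
    rcases hl a ha b hb hne with h | h
    · exact absurd hab (hmono a ha b hb h).ne
    · exact absurd hab (hmono b hb a ha h).ne'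
  have hlt : ∀ a ∈ s, rk a < s.card := fun a ha =>
    Finset.card_lt_card ⟨Finset.filter_subset _ _, fun hsub =>
      hi a ha (Finset.mem_filter.1 (hsub ha)).2⟩
  have himg : s.image rk = Finset.range s.card := by
    refine Finset.eq_of_subset_of_card_le (fun x hx => ?_) ?_
    · obtain ⟨a, ha, rfl⟩ := Finset.mem_image.1 hx
      exact Finset.mem_range.2 (hlt a ha)
    · rw [Finset.card_image_of_injOn hinj, Finset.card_range]
  have h2 : (initialPart lt s q).image rk = Finset.range (q + 1) := by
    ext x
    simp only [Finset.mem_image, initialPart, Finset.mem_filter, Finset.mem_range]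
    constructor
    · rintro ⟨a, ⟨_, ha⟩, rfl⟩
      exact Nat.lt_succ_of_le ha
    · intro hx
      have : x ∈ s.image rk := by rw [himg]; exact Finset.mem_range.2 (by omega)
      obtain ⟨a, ha, rfl⟩ := Finset.mem_image.1 this
      exact ⟨a, ⟨ha, Nat.le_of_lt_succ hx⟩, rfl⟩
  rw [← Finset.card_range (q + 1), ← h2, Finset.card_image_of_injOn]
  exact hinj.mono fun a ha => (Finset.mem_filter.1 ha).1

/-- The front `q`-face of an `n`-simplex: its first `q + 1` vertices. -/
def LocalOrder.front {A : Type*} {K L : PreAbstractSimplicialComplex A} (o : LocalOrder K)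
    {n q : ℕ} (hq : q ≤ n) (s : Simplex K L n) : Simplex K ⊥ q :=
  have hc : (initialPart o.lt s.1 q).card = q + 1 :=
    card_initialPart _ _ _ (o.irrefl _ s.2.1) (o.trans _ s.2.1) (o.total _ s.2.1)
      (by rw [s.2.2.1]; omega)
  ⟨initialPart o.lt s.1 q, (K.isRelLowerSet_faces s.2.1).2 (Finset.filter_subset _ _)
    (Finset.card_pos.1 (by rw [hc]; omega)), hc, fun h => h⟩

/-- The back `p`-face of an `n`-simplex: its last `p + 1` vertices. -/
def LocalOrder.back {A : Type*} {K L : PreAbstractSimplicialComplex A} (o : LocalOrder K)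
    {n p : ℕ} (hp : p ≤ n) (s : Simplex K L n) : Simplex K ⊥ p :=
  have hc : (initialPart (fun a b => o.lt b a) s.1 p).card = p + 1 :=
    card_initialPart _ _ _ (o.irrefl _ s.2.1)
      (fun a ha b hb c hc h1 h2 => o.trans _ s.2.1 c hc b hb a ha h2 h1)
      (fun a ha b hb hab => (o.total _ s.2.1 a ha b hb hab).symm)
      (by rw [s.2.2.1]; omega)
  ⟨initialPart (fun a b => o.lt b a) s.1 p,
    (K.isRelLowerSet_faces s.2.1).2 (Finset.filter_subset _ _)
    (Finset.card_pos.1 (by rw [hc]; omega)), hc, fun h => h⟩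

/-- The simplicial chains of `(K, L)` with integral coefficients, based by the simplices of `K` not
in `L` (oriented by a local ordering of the vertices). -/
abbrev IntChain {A : Type*} (K L : PreAbstractSimplicialComplex A) (p : ℕ) : Type _ :=
  Simplex K L p →₀ ℤ

/-- The incidence number of `s` with its codimension one face `t`: if `t` arises from `s` by
omitting the `i`-th vertex, this is `(-1)ⁱ`. -/
def LocalOrder.incidence {A : Type*} {K : PreAbstractSimplicialComplex A} (o : LocalOrder K)
    (s t : Finset A) : ℤ :=
  ∑ v ∈ s \ t, (-1) ^ (s.filter fun w => o.lt w v).card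

/-- `z` is an (oriented) fundamental cycle of the `n`-dimensional pair `(K, L)`: all `n`-simplices
have coefficient `±1`, and the boundary of `z` lies in `L`, i.e. each `(n-1)`-simplex not in `L` has
coefficient `0` in the boundary. -/
structure IsFundamentalCycle {A : Type*} {K : PreAbstractSimplicialComplex A} (o : LocalOrder K)
    (L : PreAbstractSimplicialComplex A) (n : ℕ) (z : IntChain K ⊥ n) : Prop where
  unit : ∀ s, z s = 1 ∨ z s = -1
  cycle : ∀ t ∈ K.faces, t ∉ L.faces → t.card = n →
    (z.sum fun s c => if t ⊆ s.1 then c * o.incidence s.1 t else 0) = 0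

/-! ### Square-summable functions -/

/-- The Hilbert space of square-summable complex functions on `I`. -/
abbrev Ell2 (I : Type*) : Type _ := lp (fun _ : I => ℂ) 2

theorem memℓp_two_of_le {I J : Type*} (w : I → ℂ) (F : J → ℝ) (hF : Summable F)
    (s : I → J) (hs : ∀ k k', w k ≠ 0 → w k' ≠ 0 → s k = s k' → k = k')
    (h : ∀ k, w k ≠ 0 → ‖w k‖ ^ 2 ≤ F (s k)) : Memℓp w 2 := by
  refine memℓp_gen ?_
  have hinj : Function.Injective (fun k : {k // w k ≠ 0} => s k.1) := fun k k' hk =>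
    Subtype.ext (hs _ _ k.2 k'.2 hk)
  have h1 := hF.comp_injective hinj
  have h2 : Summable (fun k : {k // w k ≠ 0} => ‖w k.1‖ ^ 2) :=
    Summable.of_nonneg_of_le (fun _ => by positivity) (fun k => h k.1 k.2) h1
  have h3 : Summable (fun k => ‖w k‖ ^ 2) := by
    have := (summable_subtype_iff_indicator (f := fun k => ‖w k‖ ^ 2)
      (s := {k | w k ≠ 0})).1 h2
    convert this using 1
    ext k
    by_cases hk : w k = 0 <;> simp [Set.indicator, hk]
  simpa using h3

theorem ell2_summable {I : Type*} (v : Ell2 I) : Summable fun i => ‖v i‖ ^ 2 := by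
  simpa using (lp.memℓp v).summable (by norm_num)

/-- Transport of functions along a partially defined injective map `e : J → I`: the value of the
new function at `j` is `v (e j)` where `e` is defined, and `0` elsewhere. -/
def Ell2.transport {I J : Type*} (e : J → Option I)
    (he : ∀ j j' i, e j = some i → e j' = some i → j = j') : Ell2 I →ₗ[ℂ] Ell2 J where
  toFun v := ⟨fun j => (e j).elim 0 v, by
    rcases isEmpty_or_nonempty I with hI | hI
    · have : (fun j => (e j).elim (0 : ℂ) v) = 0 := by
        funext j
        cases h : e j with
        | none => simp
        | some i => exact (hI.false i).elim
      rw [this]; exact zero_memℓp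
    · obtain ⟨i₀⟩ := hI
      refine memℓp_two_of_le _ _ (ell2_summable v) (fun j => (e j).getD i₀) ?_ ?_
      · intro j j' h h' hjj
        cases hj : e j with
        | none => simp [hj] at h
        | some i =>
          cases hj' : e j' with
          | none => simp [hj'] at h'
          | some i' =>
            simp only [hj, hj', Option.getD_some] at hjj
            exact he j j' i hj (by rw [hj', hjj])
      · intro j h
        cases hj : e j with
        | none => simp [hj] at h
        | some i => simp⟩
  map_add' v w := by
    ext j
    change (e j).elim 0 (v + w) = (e j).elim 0 v + (e j).elim 0 w
    cases e j
    · exact (add_zero (0 : ℂ)).symm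
    · rfl
  map_smul' c v := by
    ext j
    change (e j).elim 0 (c • v) = c • (e j).elim 0 v
    cases e j
    · exact (smul_zero c).symm
    · rfl

@[simp] theorem Ell2.transport_apply {I J : Type*} (e : J → Option I)
    (he : ∀ j j' i, e j = some i → e j' = some i → j = j') (v : Ell2 I) (j : J) :
    Ell2.transport e he v j = (e j).elim 0 v := rfl

theorem Ell2.norm_transport_le {I J : Type*} (e : J → Option I)
    (he : ∀ j j' i, e j = some i → e j' = some i → j = j') (v : Ell2 I) :
    ‖Ell2.transport e he v‖ ≤ ‖v‖ := by
  refine lp.norm_le_of_forall_sum_le (by norm_num) (norm_nonneg v) fun S => ?_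
  have h1 : ∑ j ∈ S, ‖Ell2.transport e he v j‖ ^ (2 : ENNReal).toReal =
      ∑ j ∈ S.filter (fun j => (e j).isSome),
        ‖Ell2.transport e he v j‖ ^ (2 : ENNReal).toReal := by
    refine (Finset.sum_filter_of_ne fun j _ hj => ?_).symm
    cases h : e j with
    | none => simp [h] at hj
    | some i => rfl
  rw [h1]
  have h2 := lp.sum_rpow_le_norm_rpow (p := 2) (by norm_num) v
    (S.filterMap e fun a a' b h h' => he a a' b h h')
  refine le_trans (le_of_eq ?_) h2
  refine Finset.sum_bij (fun j hj => (e j).get (Finset.mem_filter.1 hj).2) ?_ ?_ ?_ ?_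
  · intro j hj
    rw [Finset.mem_filterMap]
    exact ⟨j, (Finset.mem_filter.1 hj).1, by simp⟩
  · intro j hj j' hj' h
    refine he j j' ((e j).get (Finset.mem_filter.1 hj).2) (by simp) ?_
    rw [h]
    simp
  · intro i hi
    obtain ⟨j, hj, hji⟩ := (Finset.mem_filterMap _).1 hi
    exact ⟨j, Finset.mem_filter.2 ⟨hj, by simp [hji]⟩, by simp [hji]⟩
  · intro j hj
    have := (Finset.mem_filter.1 hj).2
    obtain ⟨i, hi⟩ := Option.isSome_iff_exists.1 this
    simp [hi]

/-- Left translation on `l²(Γ)`, the linear extension of `h ↦ g * h`. -/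
def Ell2.left {Γ : Type*} [Group Γ] (g : Γ) : Ell2 Γ →ₗ[ℂ] Ell2 Γ :=
  Ell2.transport (fun h => some (g⁻¹ * h)) (by
    intro j j' i h h'
    exact mul_left_cancel (Option.some.inj (h.trans h'.symm)))

/-- Right translation on `l²(Γ)`, the linear extension of `h ↦ h * g`. -/
def Ell2.right {Γ : Type*} [Group Γ] (g : Γ) : Ell2 Γ →ₗ[ℂ] Ell2 Γ :=
  Ell2.transport (fun h => some (h * g⁻¹)) (by
    intro j j' i h h'
    exact mul_right_cancel (Option.some.inj (h.trans h'.symm)))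

/-- The anti-linear involution of `l²(Γ)`: the anti-linear extension of `g ↦ g⁻¹`. -/
def Ell2.inv {Γ : Type*} [Group Γ] : Ell2 Γ →ₛₗ[starRingEnd ℂ] Ell2 Γ where
  toFun v := star (Ell2.transport (fun g : Γ => some g⁻¹) (by
    intro j j' i h h'
    exact inv_injective (Option.some.inj (h.trans h'.symm))) v)
  map_add' v w := by rw [map_add, star_add]
  map_smul' c v := by rw [map_smul, star_smul]; rfl

/-! ### Normal coverings of finite simplicial pairs -/

/-- `q : K' → K` is a (simplicial) normal covering with group of deck transformations `G`, which
acts on `K'` through `ρ`: `q` is simplicial and bijective on stars, and `G` acts simplicially over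
`K` and simply transitively on the fibres. -/
structure IsNormalCovering {G A B : Type*} [Group G] (K' : PreAbstractSimplicialComplex B)
    (K : PreAbstractSimplicialComplex A) (q : B → A) (ρ : G →* Equiv.Perm B) : Prop where
  nondegenerate : IsNondegenerate q K' K
  surjective : ∀ a, {a} ∈ K.faces → ∃ b, {b} ∈ K'.faces ∧ q b = a
  lift : ∀ s ∈ K.faces, ∀ b, {b} ∈ K'.faces → q b ∈ s →
    ∃! s', s' ∈ K'.faces ∧ b ∈ s' ∧ s'.image q = s
  act_mem : ∀ g, ∀ s ∈ K'.faces, s.image (ρ g) ∈ K'.faces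
  act_over : ∀ g b, {b} ∈ K'.faces → q (ρ g b) = q b
  simplyTransitive : ∀ b b', {b} ∈ K'.faces → {b'} ∈ K'.faces → q b = q b' → ∃! g, ρ g b = b'

/-- A finite simplicial pair `(X, L)` with two normal coverings `Xt → Xb → X` with covering groups
`π → Γ`, and the preimages `Lt`, `Lb` of `L`. (For connected `X` one can take the universal
covering `Xt` of `X` and `π` its fundamental group.) -/
structure CoveredPair (Γ π A B C : Type*) [Group Γ] [Group π] where
  X : PreAbstractSimplicialComplex A
  L : PreAbstractSimplicialComplex A
  Xb : PreAbstractSimplicialComplex B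
  Lb : PreAbstractSimplicialComplex B
  Xt : PreAbstractSimplicialComplex C
  Lt : PreAbstractSimplicialComplex C
  finite : X.faces.Finite
  L_le : L ≤ X
  /-- the covering map `Xb → X` -/
  q : B → A
  /-- the covering map `Xt → Xb` -/
  p : C → B
  ρ : Γ →* Equiv.Perm B
  ρt : π →* Equiv.Perm C
  φ : π →* Γ
  φ_surjective : Function.Surjective φ
  covering : IsNormalCovering Xb X q ρ
  coveringt : IsNormalCovering Xt X (q ∘ p) ρt
  p_nondegenerate : IsNondegenerate p Xt Xb
  p_equivariant : ∀ g c, {c} ∈ Xt.faces → p (ρt g c) = ρ (φ g) (p c)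
  mem_Lb : ∀ s, s ∈ Lb.faces ↔ s ∈ Xb.faces ∧ s.image q ∈ L.faces
  mem_Lt : ∀ s, s ∈ Lt.faces ↔ s ∈ Xt.faces ∧ s.image (q ∘ p) ∈ L.faces

namespace CoveredPair

variable {Γ π A B C : Type*} [Group Γ] [Group π]

/-- The pair `(X, ∅)` with the same coverings. -/
abbrev absolute (T : CoveredPair Γ π A B C) : CoveredPair Γ π A B C :=
  { T with
    L := ⊥
    Lb := ⊥
    Lt := ⊥
    L_le := bot_le
    mem_Lb := fun _ => ⟨fun h => h.elim, fun h => h.2.elim⟩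
    mem_Lt := fun _ => ⟨fun h => h.elim, fun h => h.2.elim⟩ }

theorem vertex_mem {A : Type*} {K : PreAbstractSimplicialComplex A} {s : Finset A}
    (hs : s ∈ K.faces) {a : A} (ha : a ∈ s) : {a} ∈ K.faces :=
  (K.isRelLowerSet_faces hs).2 (Finset.singleton_subset_iff.2 ha) (Finset.singleton_nonempty a)

theorem image_act {G A B : Type*} [Group G] {K' : PreAbstractSimplicialComplex B}
    {K : PreAbstractSimplicialComplex A} {q : B → A} {ρ : G →* Equiv.Perm B}
    (h : IsNormalCovering K' K q ρ) (g : G) {s : Finset B} (hs : s ∈ K'.faces) :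
    (s.image (ρ g)).image q = s.image q := by
  rw [Finset.image_image]
  exact Finset.image_congr fun b hb => h.act_over g b (vertex_mem hs hb)

/-- A finite pair `(U, V)` as a pair with trivial coverings. -/
def ofFinite (U V : PreAbstractSimplicialComplex B) (hV : V ≤ U) (hU : U.faces.Finite) :
    CoveredPair Unit Unit B B B :=
  have hid : IsNormalCovering U U id (1 : Unit →* Equiv.Perm B) :=
    { nondegenerate := fun s hs => ⟨by rwa [Finset.image_id], Set.injOn_id _⟩
      surjective := fun a ha => ⟨a, ha, rfl⟩
      lift := fun s hs b _ hbs => ⟨s, ⟨hs, hbs, Finset.image_id⟩, fun s' hs' => by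
        have := hs'.2.2
        rwa [Finset.image_id] at this⟩
      act_mem := fun g s hs => by
        change s.image id ∈ _
        rwa [Finset.image_id]
      act_over := fun _ _ _ => rfl
      simplyTransitive := fun b b' _ _ h => ⟨1, h, fun _ _ => rfl⟩ }
  { X := U
    L := V
    Xb := U
    Lb := V
    Xt := U
    Lt := V
    finite := hU
    L_le := hV
    q := id
    p := id
    ρ := 1
    ρt := 1
    φ := MonoidHom.id Unit
    φ_surjective := Function.surjective_id
    covering := hid
    coveringt := hid
    p_nondegenerate := hid.nondegenerate
    p_equivariant := fun _ _ _ => rfl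
    mem_Lb := fun s => by rw [Finset.image_id]; exact ⟨fun h => ⟨hV h, h⟩, fun h => h.2⟩
    mem_Lt := fun s => by
      rw [Function.comp_id, Finset.image_id]; exact ⟨fun h => ⟨hV h, h⟩, fun h => h.2⟩ }

variable (T : CoveredPair Γ π A B C) {n p q : ℕ}

/-- The projection of simplices from `Xb` to `X`. -/
def projX : Simplex T.Xb T.Lb p → Simplex T.X T.L p :=
  Simplex.map T.q T.covering.nondegenerate fun s hs h => (T.mem_Lb s).2 ⟨hs, h⟩

/-- The projection of simplices from `Xt` to `Xb`. -/
def projB : Simplex T.Xt T.Lt p → Simplex T.Xb T.Lb p :=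
  Simplex.map T.p T.p_nondegenerate fun s hs h => (T.mem_Lt s).2 ⟨hs, by
    rw [← Finset.image_image]; exact ((T.mem_Lb _).1 h).2⟩

/-- The projection of simplices from `Xt` to `X`. -/
def projT : Simplex T.Xt T.Lt p → Simplex T.X T.L p :=
  Simplex.map (T.q ∘ T.p) T.coveringt.nondegenerate fun s hs h => (T.mem_Lt s).2 ⟨hs, h⟩

/-- The action of `Γ` on the simplices of `Xb`. -/
def actB (g : Γ) : Simplex T.Xb T.Lb p → Simplex T.Xb T.Lb p :=
  Simplex.map (T.ρ g) (fun s hs => ⟨T.covering.act_mem g s hs, (T.ρ g).injective.injOn⟩)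
    fun s hs h => (T.mem_Lb s).2 ⟨hs, by
      rw [← image_act T.covering g hs]; exact ((T.mem_Lb _).1 h).2⟩

/-- The action of `π` on the simplices of `Xt`. -/
def actT (g : π) : Simplex T.Xt T.Lt p → Simplex T.Xt T.Lt p :=
  Simplex.map (T.ρt g) (fun s hs => ⟨T.coveringt.act_mem g s hs, (T.ρt g).injective.injOn⟩)
    fun s hs h => (T.mem_Lt s).2 ⟨hs, by
      rw [← image_act T.coveringt g hs]; exact ((T.mem_Lt _).1 h).2⟩

theorem actB_mul (g h : Γ) (s : Simplex T.Xb T.Lb p) :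
    T.actB (g * h) s = T.actB g (T.actB h s) := by
  apply Subtype.ext
  simp only [actB, Simplex.map, Finset.image_image, map_mul, Equiv.Perm.coe_mul]

theorem actB_one (s : Simplex T.Xb T.Lb p) : T.actB 1 s = s := by
  apply Subtype.ext
  simp [actB, Simplex.map]

/-- A simplex of a covering is determined by its image and one of its vertices. -/
theorem eq_of_image_eq {G A B : Type*} [Group G] {K' : PreAbstractSimplicialComplex B}
    {K : PreAbstractSimplicialComplex A} {q : B → A} {ρ : G →* Equiv.Perm B}
    (h : IsNormalCovering K' K q ρ) {s t : Finset B} (hs : s ∈ K'.faces) (ht : t ∈ K'.faces)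
    (hst : s.image q = t.image q) {b : B} (hbs : b ∈ s) (hbt : b ∈ t) : s = t :=
  (h.lift _ (h.nondegenerate s hs).1 b (vertex_mem hs hbs)
    (Finset.mem_image_of_mem q hbs)).unique ⟨hs, hbs, rfl⟩ ⟨ht, hbt, hst.symm⟩

theorem actB_injective (s : Simplex T.Xb T.Lb p) {g h : Γ} (hgh : T.actB g s = T.actB h s) :
    g = h := by
  obtain ⟨b, hb⟩ : s.1.Nonempty := (T.Xb.isRelLowerSet_faces s.2.1).1
  have hvb := vertex_mem s.2.1 hb
  have hval : s.1.image (T.ρ g) = s.1.image (T.ρ h) := congrArg Subtype.val hgh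
  have hmem : T.ρ g b ∈ s.1.image (T.ρ h) := hval ▸ Finset.mem_image_of_mem _ hb
  obtain ⟨b', hb', hbb⟩ := Finset.mem_image.1 hmem
  have hq : T.q b' = T.q b := by
    rw [← T.covering.act_over h b' (vertex_mem s.2.1 hb'), hbb, T.covering.act_over g b hvb]
  have : b' = b := (T.covering.nondegenerate s.1 s.2.1).2 hb' hb hq
  subst this
  have hv' : {T.ρ h b'} ∈ T.Xb.faces := by
    have := T.covering.act_mem h _ hvb
    rwa [Finset.image_singleton] at this
  exact (T.covering.simplyTransitive b' (T.ρ h b') hvb hv'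
    (T.covering.act_over h b' hvb).symm).unique hbb.symm rfl

theorem projB_actT (g : π) (s : Simplex T.Xt T.Lt p) :
    T.projB (T.actT g s) = T.actB (T.φ g) (T.projB s) := by
  apply Subtype.ext
  simp only [projB, actB, actT, Simplex.map, Finset.image_image]
  exact Finset.image_congr fun c hc => T.p_equivariant g c (vertex_mem s.2.1 hc)

theorem projX_actB (g : Γ) (s : Simplex T.Xb T.Lb p) : T.projX (T.actB g s) = T.projX s :=
  Subtype.ext (image_act T.covering g s.2.1)

theorem projX_projB (s : Simplex T.Xt T.Lt p) : T.projX (T.projB s) = T.projT s :=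
  Subtype.ext (by simp only [projB, projX, projT, Simplex.map, Finset.image_image])

/-- `π` acts transitively on the simplices over a given simplex. -/
theorem exists_actT_eq (s t : Simplex T.Xt T.Lt p) (h : T.projT s = T.projT t) :
    ∃ g, T.actT g s = t := by
  have hval : s.1.image (T.q ∘ T.p) = t.1.image (T.q ∘ T.p) := congrArg Subtype.val h
  obtain ⟨b, hb⟩ : s.1.Nonempty := (T.Xt.isRelLowerSet_faces s.2.1).1
  have : (T.q ∘ T.p) b ∈ t.1.image (T.q ∘ T.p) := hval ▸ Finset.mem_image_of_mem _ hb
  obtain ⟨c, hc, hcb⟩ := Finset.mem_image.1 this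
  obtain ⟨g, hg, -⟩ := T.coveringt.simplyTransitive b c (vertex_mem s.2.1 hb)
    (vertex_mem t.2.1 hc) hcb.symm
  refine ⟨g, Subtype.ext (eq_of_image_eq T.coveringt (T.actT g s).2.1 t.2.1 ?_ (b := c) ?_ hc)⟩
  · exact (image_act T.coveringt g s.2.1).trans hval
  · exact hg ▸ Finset.mem_image_of_mem _ hb

theorem exists_actT_eq' (s t : Simplex T.Xt T.Lt p) (γ : Γ)
    (h : T.actB γ (T.projB s) = T.projB t) : ∃ g, T.φ g = γ ∧ T.actT g s = t := by
  obtain ⟨g, hg⟩ := T.exists_actT_eq s t (by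
    rw [← projX_projB, ← projX_projB, ← h, projX_actB])
  refine ⟨g, T.actB_injective (T.projB s) ?_, hg⟩
  rw [← projB_actT, hg, h]

theorem exists_projT_eq (s : Simplex T.X T.L p) : ∃ t : Simplex T.Xt T.Lt p, T.projT t = s := by
  obtain ⟨a, ha⟩ : s.1.Nonempty := (T.X.isRelLowerSet_faces s.2.1).1
  obtain ⟨b, hb, hba⟩ := T.coveringt.surjective a (vertex_mem s.2.1 ha)
  obtain ⟨t, ⟨ht, -, hts⟩, -⟩ := T.coveringt.lift s.1 s.2.1 b hb (hba ▸ ha)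
  refine ⟨⟨t, ht, ?_, fun h => s.2.2.2 (hts ▸ ((T.mem_Lt t).1 h).2)⟩, Subtype.ext hts⟩
  rw [← s.2.2.1, ← hts, Finset.card_image_of_injOn (T.coveringt.nondegenerate t ht).2]

theorem exists_projB_eq (s : Simplex T.Xb T.Lb p) : ∃ t : Simplex T.Xt T.Lt p, T.projB t = s := by
  obtain ⟨t, ht⟩ := T.exists_projT_eq (T.projX s)
  have hval : t.1.image (T.q ∘ T.p) = s.1.image T.q := congrArg Subtype.val ht
  obtain ⟨c, hc⟩ : t.1.Nonempty := (T.Xt.isRelLowerSet_faces t.2.1).1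
  have : (T.q ∘ T.p) c ∈ s.1.image T.q := hval ▸ Finset.mem_image_of_mem _ hc
  obtain ⟨b, hb, hbc⟩ := Finset.mem_image.1 this
  obtain ⟨γ, hγ, -⟩ := T.covering.simplyTransitive (T.p c) b
    (vertex_mem (T.projB t).2.1 (Finset.mem_image_of_mem _ hc)) (vertex_mem s.2.1 hb) hbc.symm
  obtain ⟨g, rfl⟩ := T.φ_surjective γ
  refine ⟨T.actT g t, Subtype.ext (eq_of_image_eq T.covering
    (T.projB _).2.1 s.2.1 ?_ (b := b) ?_ hb)⟩
  · refine (congrArg Subtype.val (T.projX_projB (T.actT g t))).trans ?_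
    exact (image_act T.coveringt g t.2.1).trans hval
  · rw [projB_actT, ← hγ]
    exact Finset.mem_image_of_mem _ (Finset.mem_image_of_mem _ hc)

/-- A chosen lift to `Xt` of a simplex of `X`. -/
def liftT (s : Simplex T.X T.L p) : Simplex T.Xt T.Lt p := (T.exists_projT_eq s).choose

/-- A chosen lift to `Xt` of a simplex of `Xb`. -/
def liftB (s : Simplex T.Xb T.Lb p) : Simplex T.Xt T.Lt p := (T.exists_projB_eq s).choose

theorem projT_liftT (s : Simplex T.X T.L p) : T.projT (T.liftT s) = s :=
  (T.exists_projT_eq s).choose_spec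

theorem projB_liftB (s : Simplex T.Xb T.Lb p) : T.projB (T.liftB s) = s :=
  (T.exists_projB_eq s).choose_spec

/-! ### The `l²`-(co)chain modules -/

/-- The action of `π` on the chains `C_p(Xt, Lt)`. -/
def chainAct (p : ℕ) (g : π) : IntChain T.Xt T.Lt p →ₗ[ℤ] IntChain T.Xt T.Lt p :=
  Finsupp.lmapDomain ℤ ℤ (T.actT g)

/-- The `l²`-cochains `C^p_(2)(Xb, Lb) = Hom_{ℤπ}(C_p(Xt, Lt), l²(Γ))`. -/
def L2Cochain (p : ℕ) : Submodule ℂ (IntChain T.Xt T.Lt p →ₗ[ℤ] Ell2 Γ) where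
  carrier := {α | ∀ g c, α (T.chainAct p g c) = Ell2.left (T.φ g) (α c)}
  zero_mem' g c := by simp
  add_mem' {α β} hα hβ g c := by
    rw [LinearMap.add_apply, LinearMap.add_apply, hα, hβ, map_add]
  smul_mem' r α hα g c := by
    rw [LinearMap.smul_apply, LinearMap.smul_apply, hα, map_smul]

/-- The relations `(v · φ(g)) ⊗ c = v ⊗ (g c)`. -/
def balancedRelations (p : ℕ) : Submodule ℂ (Ell2 Γ ⊗[ℤ] IntChain T.Xt T.Lt p) :=
  Submodule.span ℂ {x | ∃ (g : π) (v : Ell2 Γ) (c : IntChain T.Xt T.Lt p),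
    x = (Ell2.right (T.φ g) v) ⊗ₜ[ℤ] c - v ⊗ₜ[ℤ] (T.chainAct p g c)}

/-- The `l²`-chains `C_p^(2)(Xb, Lb) = l²(Γ) ⊗_{ℤπ} C_p(Xt, Lt)`. -/
abbrev L2Chain (p : ℕ) : Type _ :=
  (Ell2 Γ ⊗[ℤ] IntChain T.Xt T.Lt p) ⧸ T.balancedRelations p

/-- The projection `C_p(Xt) → C_p(Xt, Lt)`, which omits the simplices in `Lt`. -/
def toRelative (p : ℕ) : IntChain T.absolute.Xt T.absolute.Lt p →ₗ[ℤ] IntChain T.Xt T.Lt p :=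
  Finsupp.linearCombination ℤ fun s =>
    if h : s.1 ∈ T.Lt.faces then 0 else Finsupp.single ⟨s.1, s.2.1, s.2.2.1, h⟩ 1

theorem toRelative_chainAct (g : π) (c : IntChain T.absolute.Xt T.absolute.Lt p) :
    T.toRelative p (T.absolute.chainAct p g c) = T.chainAct p g (T.toRelative p c) := by
  induction c using Finsupp.induction_linear with
  | zero => simp
  | add c d hc hd => rw [map_add, map_add, map_add, map_add, hc, hd]
  | single s k =>
    have hiff : s.1.image (T.ρt g) ∈ T.Lt.faces ↔ s.1 ∈ T.Lt.faces := by
      have hs : s.1 ∈ T.Xt.faces := s.2.1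
      rw [T.mem_Lt, T.mem_Lt, image_act T.coveringt g hs]
      exact and_congr_left fun _ => iff_of_true (T.coveringt.act_mem g _ hs) hs
    simp only [toRelative, chainAct, Finsupp.lmapDomain_apply, Finsupp.mapDomain_single,
      Finsupp.linearCombination_single]
    by_cases h : s.1 ∈ T.Lt.faces
    · rw [dif_pos h, dif_pos (show (T.absolute.actT g s).1 ∈ T.Lt.faces from hiff.2 h)]
      simp
    · rw [dif_neg h, dif_neg (show ¬ (T.absolute.actT g s).1 ∈ T.Lt.faces from
        fun h' => h (hiff.1 h')), Finsupp.mapDomain_smul, Finsupp.mapDomain_single]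
      rfl

/-- The map `C_p^(2)(Xb) → C_p^(2)(Xb, Lb)` induced by the inclusion of pairs. -/
def toRelativeL2 (p : ℕ) : T.absolute.L2Chain p →ₗ[ℂ] T.L2Chain p :=
  Submodule.mapQ _ _
    (TensorProduct.AlgebraTensorModule.map LinearMap.id (T.toRelative p)) (by
      refine Submodule.span_le.2 ?_
      rintro _ ⟨g, v, c, rfl⟩
      refine Submodule.subset_span ⟨g, v, T.toRelative p c, ?_⟩
      rw [map_sub, TensorProduct.AlgebraTensorModule.map_tmul,
        TensorProduct.AlgebraTensorModule.map_tmul, toRelative_chainAct]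
      rfl)

/-! ### Identification with `l²`-functions on simplices -/

/-- `∑ λ_g g ↦ ∑ λ_g (g s)`, for a simplex `s` of `Xb`. -/
def orbitMap (s : Simplex T.Xb T.Lb p) : Ell2 Γ →ₗ[ℂ] Ell2 (Simplex T.Xb T.Lb p) :=
  Ell2.transport (fun t => if h : ∃ g, T.actB g s = t then some h.choose else none) (by
    intro t t' g h h'
    split_ifs at h h' with h1 h2
    rw [← h1.choose_spec, ← h2.choose_spec, Option.some.inj h, Option.some.inj h'])

theorem orbitMap_apply_act (s : Simplex T.Xb T.Lb p) (v : Ell2 Γ) (g : Γ) :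
    T.orbitMap s v (T.actB g s) = v g := by
  have h : ∃ h, T.actB h s = T.actB g s := ⟨g, rfl⟩
  rw [orbitMap, Ell2.transport_apply, dif_pos h]
  exact congrArg v (T.actB_injective s h.choose_spec)

theorem orbitMap_apply_of_not (s : Simplex T.Xb T.Lb p) (v : Ell2 Γ) (t : Simplex T.Xb T.Lb p)
    (h : ¬ ∃ g, T.actB g s = t) : T.orbitMap s v t = 0 := by
  rw [orbitMap, Ell2.transport_apply, dif_neg h]
  rfl

theorem orbitMap_right (s : Simplex T.Xb T.Lb p) (v : Ell2 Γ) (g : Γ) :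
    T.orbitMap s (Ell2.right g v) = T.orbitMap (T.actB g s) v := by
  ext t
  by_cases h : ∃ k, T.actB k s = t
  · obtain ⟨k, rfl⟩ := h
    have : T.actB k s = T.actB (k * g⁻¹) (T.actB g s) := by rw [← actB_mul]; simp
    rw [orbitMap_apply_act, this, orbitMap_apply_act]
    rfl
  · rw [orbitMap_apply_of_not _ _ _ _ h, orbitMap_apply_of_not]
    rintro ⟨k, hk⟩
    exact h ⟨k * g, by rw [actB_mul, hk]⟩

/-- The linear map `l²(Γ) ⊗_ℤ C_p(Xt, Lt) → l²(simplices)`,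
`(∑ λ_g g) ⊗ s ↦ ∑ λ_g g · (image of s in Xb)`. -/
def tensorToFun (p : ℕ) :
    (Ell2 Γ ⊗[ℤ] IntChain T.Xt T.Lt p) →ₗ[ℂ] Ell2 (Simplex T.Xb T.Lb p) :=
  TensorProduct.AlgebraTensorModule.lift
    (LinearMap.flip (Finsupp.linearCombination ℤ fun s => T.orbitMap (T.projB s)))

theorem tensorToFun_single (v : Ell2 Γ) (s : Simplex T.Xt T.Lt p) (k : ℤ) :
    T.tensorToFun p (v ⊗ₜ Finsupp.single s k) = k • T.orbitMap (T.projB s) v := by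
  simp [tensorToFun]

/-- The identification of `l²`-chains with `l²`-functions on the simplices of `Xb` not in `Lb`:
`(∑ λ_g g) ⊗ s ↦ ∑ λ_g g · (image of s in Xb)`. -/
def chainToFun (p : ℕ) : T.L2Chain p →ₗ[ℂ] Ell2 (Simplex T.Xb T.Lb p) :=
  Submodule.liftQ _ (T.tensorToFun p) (by
    refine Submodule.span_le.2 ?_
    rintro _ ⟨g, v, c, rfl⟩
    change T.tensorToFun p _ = 0
    rw [map_sub, sub_eq_zero]
    induction c using Finsupp.induction_linear with
    | zero => simp
    | add c d hc hd =>
      rw [TensorProduct.tmul_add, map_add, hc, hd, map_add, TensorProduct.tmul_add, map_add]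
    | single s k =>
      rw [chainAct, Finsupp.lmapDomain_apply, Finsupp.mapDomain_single, tensorToFun_single,
        tensorToFun_single, orbitMap_right, projB_actT])

theorem cochain_act (α : T.L2Cochain p) (g : π) (s : Simplex T.Xt T.Lt p) :
    α.1 (Finsupp.single (T.actT g s) 1) = Ell2.left (T.φ g) (α.1 (Finsupp.single s 1)) := by
  have := α.2 g (Finsupp.single s 1)
  rwa [chainAct, Finsupp.lmapDomain_apply, Finsupp.mapDomain_single] at this

theorem left_apply (g h : Γ) (v : Ell2 Γ) : Ell2.left g v h = v (g⁻¹ * h) := rfl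

theorem finite_simplex (p : ℕ) : Finite (Simplex T.X T.L p) := by
  have : Finite T.X.faces := T.finite.to_subtype
  exact Finite.of_injective (β := T.X.faces) (fun s => ⟨s.1, s.2.1⟩)
    fun s t h => Subtype.ext (congrArg (fun x => x.1) h)

/-- The function `s ↦ ⟨1, α(s̃)⟩` on the simplices of `Xb`, where `s̃` is a lift of `s` to `Xt`
and the inner product of `l²(Γ)` is anti-linear in the second variable: the value at `s` is the
conjugate of the coefficient of the unit element in `α(s̃)`. -/
def cochainFun (α : T.L2Cochain p) (s : Simplex T.Xb T.Lb p) : ℂ :=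
  conj (α.1 (Finsupp.single (T.liftB s) 1) 1)

/-- The value of `cochainFun` does not depend on the choice of lifts. -/
theorem cochainFun_apply (α : T.L2Cochain p) (s : Simplex T.Xt T.Lt p) :
    T.cochainFun α (T.projB s) = conj (α.1 (Finsupp.single s 1) 1) := by
  obtain ⟨x, hx, hxs⟩ := T.exists_actT_eq' s (T.liftB (T.projB s)) 1
    (by rw [projB_liftB, actB_one])
  rw [cochainFun, ← hxs, cochain_act, left_apply, hx]
  simp

theorem memℓp_cochainFun (α : T.L2Cochain p) : Memℓp (T.cochainFun α) 2 := by
  have := T.finite_simplex p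
  have hex : ∀ s : Simplex T.Xb T.Lb p, ∃ g, T.actT g (T.liftT (T.projX s)) = T.liftB s :=
    fun s => T.exists_actT_eq _ _ (by rw [projT_liftT, ← projX_projB, projB_liftB])
  choose r hr using hex
  have hsum : Summable fun x : Simplex T.X T.L p × Γ =>
      ‖α.1 (Finsupp.single (T.liftT x.1) 1) x.2‖ ^ 2 := by
    rw [summable_prod_of_nonneg (fun x => by positivity)]
    exact ⟨fun s => ell2_summable (α.1 (Finsupp.single (T.liftT s) 1)), Summable.of_finite⟩
  refine memℓp_two_of_le _ _ hsum (fun s => (T.projX s, (T.φ (r s))⁻¹)) ?_ ?_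
  · intro s t _ _ hst
    have h1 : T.projX s = T.projX t := congrArg Prod.fst hst
    have h2 : T.φ (r s) = T.φ (r t) := inv_injective (congrArg Prod.snd hst)
    rw [← T.projB_liftB s, ← T.projB_liftB t, ← hr s, ← hr t, projB_actT, projB_actT, h1, h2]
  · intro s _
    rw [cochainFun, ← hr s, cochain_act, left_apply, mul_one, RCLike.norm_conj]

/-- The cochain `s̃ ↦ ∑_g conj (a (g⁻¹ s)) g`, where `s` is the image of `s̃` in `Xb`. -/
def funCochain (a : Ell2 (Simplex T.Xb T.Lb p)) : T.L2Cochain p :=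
  ⟨Finsupp.linearCombination ℤ fun s =>
      star (Ell2.transport (fun g : Γ => some (T.actB g⁻¹ (T.projB s))) (by
        intro g g' t h h'
        exact inv_injective (T.actB_injective _ (Option.some.inj (h.trans h'.symm)))) a), by
    intro g c
    induction c using Finsupp.induction_linear with
    | zero => simp
    | add c d hc hd => rw [map_add, map_add, hc, hd, map_add, map_add]
    | single s k =>
      rw [chainAct, Finsupp.lmapDomain_apply, Finsupp.mapDomain_single,
        Finsupp.linearCombination_single, Finsupp.linearCombination_single, map_zsmul]
      congr 1
      ext h
      rw [left_apply, lp.star_apply, lp.star_apply, Ell2.transport_apply, Ell2.transport_apply,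
        projB_actT, ← actB_mul, mul_inv_rev, inv_inv]⟩

theorem funCochain_single (a : Ell2 (Simplex T.Xb T.Lb p)) (s : Simplex T.Xt T.Lt p) (g : Γ) :
    (T.funCochain a).1 (Finsupp.single s 1) g = conj (a (T.actB g⁻¹ (T.projB s))) := by
  simp only [funCochain, Finsupp.linearCombination_single, one_smul]
  rfl

theorem cochain_ext {α β : T.L2Cochain p}
    (h : ∀ s, α.1 (Finsupp.single s 1) = β.1 (Finsupp.single s 1)) : α = β := by
  apply Subtype.ext
  apply Finsupp.lhom_ext
  intro s k
  rw [← mul_one k, ← smul_eq_mul, ← Finsupp.smul_single, map_zsmul, map_zsmul, h]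

/-- The identification of `l²`-cochains with `l²`-functions on the simplices of `Xb` not in `Lb`,
`α ↦ ∑ ⟨1, α(s̃)⟩ s`, an anti-linear isomorphism. -/
def cochainEquiv (p : ℕ) : T.L2Cochain p ≃ₛₗ[starRingEnd ℂ] Ell2 (Simplex T.Xb T.Lb p) where
  toFun α := ⟨T.cochainFun α, T.memℓp_cochainFun α⟩
  map_add' α β := by
    ext s
    exact map_add (starRingEnd ℂ) (α.1 (Finsupp.single (T.liftB s) 1) 1)
      (β.1 (Finsupp.single (T.liftB s) 1) 1)
  map_smul' c α := by
    ext s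
    exact map_mul (starRingEnd ℂ) c (α.1 (Finsupp.single (T.liftB s) 1) 1)
  invFun a := T.funCochain a
  left_inv α := by
    apply T.cochain_ext
    intro s
    ext g
    obtain ⟨x, hx, hxs⟩ := T.exists_actT_eq' s (T.liftB (T.actB g⁻¹ (T.projB s))) g⁻¹
      (T.projB_liftB _).symm
    rw [funCochain_single]
    change conj (T.cochainFun α (T.actB g⁻¹ (T.projB s))) = _
    rw [cochainFun, ← hxs, cochain_act, left_apply, hx, inv_inv, mul_one, Complex.conj_conj]
  right_inv a := by
    ext s
    change T.cochainFun (T.funCochain a) s = a s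
    rw [cochainFun, funCochain_single, inv_one, actB_one, projB_liftB, Complex.conj_conj]

/-! ### The cap product and the duality map -/

/-- The local ordering of the vertices of `Xt` lifted from `X`. -/
def orderT (o : LocalOrder T.X) : LocalOrder T.Xt :=
  o.comap (T.q ∘ T.p) T.coveringt.nondegenerate

/-- The Alexander-Spanier (front face, back face) cap product of a relative `l²`-cochain `α` with
the chain `z = ∑ z(s) s` of `X`: the `l²`-chain
`∑_s z(s) (α(b_p(s̃)))^* ⊗ f_q(s̃)`, where `s̃` is a lift of `s` to `Xt`, `f_q` and `b_p` are the
front and back face, and `*` is the involution of `l²(Γ)`. -/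
def cap (o : LocalOrder T.X) {n p q : ℕ} (hpq : p + q = n)
    (z : IntChain T.X ⊥ n) : T.L2Cochain p →ₛₗ[starRingEnd ℂ] T.absolute.L2Chain q where
  toFun α := z.sum fun s k => k • (T.absolute.balancedRelations q).mkQ
    ((Ell2.inv (α.1 (T.toRelative p
      (Finsupp.single ((T.orderT o).back (by omega) (T.absolute.liftT s)) 1)))) ⊗ₜ[ℤ]
      Finsupp.single ((T.orderT o).front (by omega) (T.absolute.liftT s)) 1)
  map_add' α β := by
    simp only [Submodule.coe_add, LinearMap.add_apply, map_add, TensorProduct.add_tmul, smul_add]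
    exact Finsupp.sum_add
  map_smul' c α := by
    simp only [Submodule.coe_smul, LinearMap.smul_apply, map_smulₛₗ, ← TensorProduct.smul_tmul',
      Finsupp.sum, Finset.smul_sum, RingHom.id_apply, smul_comm (starRingEnd ℂ c)]

/-- The Poincaré duality map `g : C^p_(2)(Xb, Lb) → C_q^(2)(Xb, Lb)`, `p + q = n`, after
identification with `l²`-functions: the cap product with the fundamental cycle `z` of `X`,
followed by the map induced by the inclusion of pairs. -/
def duality (o : LocalOrder T.X) {n p q : ℕ} (hpq : p + q = n) (z : IntChain T.X ⊥ n) :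
    Ell2 (Simplex T.Xb T.Lb p) →ₗ[ℂ] Ell2 (Simplex T.Xb T.Lb q) :=
  T.chainToFun q ∘ₗ T.toRelativeL2 q ∘ₗ
    ((T.cap o hpq z).comp (T.cochainEquiv p).symm.toLinearMap : _ →ₗ[ℂ] _)

/-- The Poincaré duality map `g_U : C^p(U, V; ℂ) → C_q(U, V; ℂ)` of a finite pair, after
identification with functions on simplices (the case of the trivial covering, where `l²(1) = ℂ`). -/
def finiteDuality (U V : PreAbstractSimplicialComplex B) (hV : V ≤ U) (hU : U.faces.Finite)
    (o : LocalOrder U) {n p q : ℕ} (hpq : p + q = n) (z : IntChain U ⊥ n) :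
    Ell2 (Simplex U V p) →ₗ[ℂ] Ell2 (Simplex U V q) :=
  (ofFinite U V hV hU).duality o hpq z

theorem nondegenerate_of_le {U : PreAbstractSimplicialComplex B} (hU : U ≤ T.Xb) :
    IsNondegenerate T.q U T.X :=
  fun s hs => T.covering.nondegenerate s (hU hs)

end CoveredPair

/-- Extension by zero `P_U^*`: a function on the simplices of `U` not in `V` is regarded as a
function on the simplices of `K` not in `L` that vanishes outside `U ∖ V`. -/
def extendByZero {A : Type*} (U V K L : PreAbstractSimplicialComplex A) (p : ℕ) :
    Ell2 (Simplex U V p) →L[ℂ] Ell2 (Simplex K L p) :=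
  LinearMap.mkContinuous
    (Ell2.transport (fun s : Simplex K L p =>
      if h : s.1 ∈ U.faces ∧ s.1 ∉ V.faces then some ⟨s.1, h.1, s.2.2.1, h.2⟩ else none) (by
        intro s t u hs ht
        split_ifs at hs ht with h1 h2
        have := Option.some.inj (hs.trans ht.symm)
        exact Subtype.ext (congrArg (fun x => x.1) this))) 1
    (fun v => by
      rw [one_mul]
      exact Ell2.norm_transport_le _ _ v)

end

noncomputable section

open scoped Classical TensorProduct ComplexConjugate

/-! ### Increasing enumerations -/

/-! After the identifications, the value of the duality map at a `q`-simplex `t` is a signed sum,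
over the `n`-simplices of the covering with front face `t`, of the values of the function at their
back faces (`duality_apply`). The map of `(U, V)` is the same sum over the `n`-simplices of `U`,
with the same signs. So the identity reduces to two local statements about interior simplices `s` of
`U`, that is, those not in `V`: they do not lie over `L` (`image_notMem_L`), so extension by zero
loses no values, and every `n`-simplex of the covering that contains `s` is in `U`
(`mem_of_subset`), so no term is missing at an interior `t`.

Both come from the top-dimensional homology of the link in `X` of the image of `s`. The signed
`n`-simplices of `U` around `s` map to a chain in the open star of this image. Lifts through `s` are
unique and `s` is not in `V`, so this chain has no boundary in the open star
(`isStarCycle_of_subcomplex`); removing the vertices of the image of `s`, with the signs `linkSign`,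
turns it into a cycle of the link. It is nonzero because a rational homology manifold is pure
(`exists_superset`). In top degree a cycle that bounds has zero coefficients. A link with the
homology of a point is therefore impossible (`IsStarCycle.eq_zero`), which is the first statement.
If the link is a homology sphere, the cycle from `U` is proportional to the one given by all
`n`-simplices of `X` around the image of `s` (`IsStarCycle.exists_proportional`). The two agree on a
simplex coming from `U`, hence everywhere; since all coefficients of the second are nonzero, every
simplex of the star comes from `U`.

Homology is defined by ordered chains, where tuples with repeated vertices occur above the top
dimension and have boundaries. The alternating functional `detFunctional` kills these boundaries and
reads off the coefficient of one top-dimensional simplex, which replaces a comparison with oriented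
chains. -/

/-- `lt` restricts to a strict total order on `s`. -/
structure StrictTotalOn {A : Type*} (lt : A → A → Prop) (s : Finset A) : Prop where
  irrefl : ∀ a ∈ s, ¬ lt a a
  trans : ∀ a ∈ s, ∀ b ∈ s, ∀ c ∈ s, lt a b → lt b c → lt a c
  total : ∀ a ∈ s, ∀ b ∈ s, a ≠ b → lt a b ∨ lt b a

theorem LocalOrder.strictTotalOn {A : Type*} {K : PreAbstractSimplicialComplex A}
    (o : LocalOrder K) {s : Finset A} (hs : s ∈ K.faces) : StrictTotalOn o.lt s :=
  ⟨o.irrefl s hs, o.trans s hs, o.total s hs⟩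

theorem StrictTotalOn.mono {A : Type*} {lt : A → A → Prop} {s t : Finset A}
    (h : StrictTotalOn lt s) (hts : t ⊆ s) : StrictTotalOn lt t :=
  ⟨fun a ha => h.irrefl a (hts ha),
    fun a ha b hb c hc => h.trans a (hts ha) b (hts hb) c (hts hc),
    fun a ha b hb => h.total a (hts ha) b (hts hb)⟩

/-- `x` enumerates `s` increasingly. -/
structure IsEnum {A : Type*} (lt : A → A → Prop) (s : Finset A) {d : ℕ} (x : Fin d → A) :
    Prop where
  image : Finset.univ.image x = s
  lt_of_lt : ∀ i j, i < j → lt (x i) (x j)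

namespace IsEnum

variable {A : Type*} {lt : A → A → Prop} {s : Finset A} {d : ℕ}

theorem mem {x : Fin d → A} (hx : IsEnum lt s x) (i : Fin d) : x i ∈ s :=
  hx.image ▸ Finset.mem_image_of_mem x (Finset.mem_univ i)

theorem exists_eq {x : Fin d → A} (hx : IsEnum lt s x) {a : A} (ha : a ∈ s) : ∃ i, x i = a := by
  rw [← hx.image] at ha
  obtain ⟨i, -, hi⟩ := Finset.mem_image.1 ha
  exact ⟨i, hi⟩

theorem injective {x : Fin d → A} (hx : IsEnum lt s x) (h : StrictTotalOn lt s) :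
    Function.Injective x := by
  intro i j hij
  rcases lt_trichotomy i j with hlt | rfl | hlt
  · have := hx.lt_of_lt i j hlt
    rw [hij] at this
    exact (h.irrefl _ (hx.mem j) this).elim
  · rfl
  · have := hx.lt_of_lt j i hlt
    rw [hij] at this
    exact (h.irrefl _ (hx.mem j) this).elim

/-- The predecessors of `x i` are the `x j` with `j < i`. This makes the enumeration unique and
turns the sign at position `i` into the sign used in `LocalOrder.incidence`. -/
theorem rank {x : Fin d → A} (hx : IsEnum lt s x) (h : StrictTotalOn lt s) (i : Fin d) :
    (s.filter fun w => lt w (x i)).card = i := by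
  have : (s.filter fun w => lt w (x i)) = (Finset.Iio i).image x := by
    ext a
    simp only [Finset.mem_filter, Finset.mem_image, Finset.mem_Iio]
    constructor
    · rintro ⟨ha, hai⟩
      obtain ⟨j, rfl⟩ := hx.exists_eq ha
      refine ⟨j, ?_, rfl⟩
      by_contra hji
      rcases (not_lt.1 hji).eq_or_lt with rfl | hij
      · exact h.irrefl _ ha hai
      · exact h.irrefl _ ha (h.trans _ ha _ (hx.mem i) _ ha hai (hx.lt_of_lt _ _ hij))
    · rintro ⟨j, hj, rfl⟩
      exact ⟨hx.mem j, hx.lt_of_lt _ _ hj⟩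
  rw [this, Finset.card_image_of_injective _ (hx.injective h), Fin.card_Iio]

theorem unique {x y : Fin d → A} (hx : IsEnum lt s x) (hy : IsEnum lt s y)
    (h : StrictTotalOn lt s) : x = y := by
  funext i
  obtain ⟨j, hj⟩ := hy.exists_eq (hx.mem i)
  have h1 := hx.rank h i
  rw [← hj, hy.rank h j] at h1
  rw [← hj, Fin.ext h1]

theorem comp_succAbove {x : Fin (d + 1) → A} (hx : IsEnum lt s x) (h : StrictTotalOn lt s)
    (i : Fin (d + 1)) : IsEnum lt (s.erase (x i)) (fun j => x (i.succAbove j)) := by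
  refine ⟨?_, fun j k hjk => hx.lt_of_lt _ _ (Fin.strictMono_succAbove i hjk)⟩
  ext a
  simp only [Finset.mem_image, Finset.mem_univ, true_and, Finset.mem_erase]
  constructor
  · rintro ⟨j, rfl⟩
    exact ⟨fun hj => Fin.succAbove_ne i j (hx.injective h hj), hx.mem _⟩
  · rintro ⟨hne, ha⟩
    obtain ⟨k, rfl⟩ := hx.exists_eq ha
    obtain ⟨j, rfl⟩ := Fin.exists_succAbove_eq (x := k) (y := i) fun hk => hne (hk ▸ rfl)
    exact ⟨j, rfl⟩

end IsEnum

theorem StrictTotalOn.exists_isEnum {A : Type*} {lt : A → A → Prop} {s : Finset A} {d : ℕ}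
    (h : StrictTotalOn lt s) (hd : s.card = d) : ∃ x : Fin d → A, IsEnum lt s x := by
  let r : s → s → Prop := fun a b => lt a b
  have : IsStrictTotalOrder s r :=
    { irrefl := fun a => h.irrefl a a.2
      trans := fun a b c => h.trans a a.2 b b.2 c c.2
      trichotomous := fun a b h1 h2 => by
        by_contra hab
        rcases h.total a a.2 b b.2 (fun hh => hab (Subtype.ext hh)) with h' | h'
        · exact h1 h'
        · exact h2 h' }
  let _ : LinearOrder s := linearOrderOfSTO r
  have hc : (Finset.univ : Finset s).card = d := by simpa using hd
  let e := (Finset.univ : Finset s).orderEmbOfFin hc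
  refine ⟨fun i => (e i).1, ?_, fun i j hij => ?_⟩
  · ext a
    simp only [Finset.mem_image, Finset.mem_univ, true_and]
    constructor
    · rintro ⟨i, rfl⟩
      exact (e i).2
    · intro ha
      have : (⟨a, ha⟩ : s) ∈ Set.range e := by
        rw [Finset.range_orderEmbOfFin]
        exact Finset.mem_coe.2 (Finset.mem_univ _)
      obtain ⟨i, hi⟩ := this
      exact ⟨i, congrArg Subtype.val hi⟩
  · exact e.strictMono hij

/-- The ordered simplex that enumerates `s` increasingly. -/
def sortedChain {A : Type*} (lt : A → A → Prop) (s : Finset A) (d : ℕ) : (Fin d → A) →₀ ℚ :=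
  if h : ∃ x : Fin d → A, IsEnum lt s x then Finsupp.single h.choose 1 else 0

theorem IsEnum.sortedChain_eq {A : Type*} {lt : A → A → Prop} {s : Finset A} {d : ℕ}
    {x : Fin d → A} (hx : IsEnum lt s x) (h : StrictTotalOn lt s) :
    sortedChain lt s d = Finsupp.single x 1 := by
  have hex : ∃ x : Fin d → A, IsEnum lt s x := ⟨x, hx⟩
  rw [sortedChain, dif_pos hex, hex.choose_spec.unique hx h]

/-- Omitting an entry of an increasing tuple leaves the increasing tuple of the smaller set, and by
`IsEnum.rank` the omitted position is the number of predecessors. -/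
theorem orderedBoundary_sortedChain {A : Type*} {lt : A → A → Prop} {s : Finset A} {d : ℕ}
    (h : StrictTotalOn lt s) (hd : s.card = d + 1) :
    orderedBoundary A d (sortedChain lt s (d + 1)) =
      ∑ v ∈ s, ((-1 : ℚ) ^ (s.filter fun w => lt w v).card) • sortedChain lt (s.erase v) d := by
  obtain ⟨x, hx⟩ := h.exists_isEnum hd
  rw [hx.sortedChain_eq h, orderedBoundary, Finsupp.linearCombination_single, one_smul]
  conv_rhs => rw [← hx.image]
  rw [Finset.sum_image fun i _ j _ hij => hx.injective h hij]
  refine Finset.sum_congr rfl fun i _ => ?_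
  rw [hx.image, hx.rank h i,
    (hx.comp_succAbove h i).sortedChain_eq (h.mono (Finset.erase_subset _ _)),
    Finsupp.smul_single, smul_eq_mul, mul_one]

/-! ### Determinants detect nondegenerate top-dimensional cycles -/

/-- The alternating functional on ordered chains that detects the ordered simplex `v`. -/
def detFunctional {A : Type*} {d : ℕ} (v : Fin d → A) : ((Fin d → A) →₀ ℚ) →ₗ[ℚ] ℚ :=
  Finsupp.linearCombination ℚ fun t =>
    Matrix.det (Matrix.of fun i j => if t i = v j then (1 : ℚ) else 0)

/-- For equal sets the matrix is the identity. For different sets of the same size, some vertex of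
`s'` is outside `s` and gives a zero row. -/
theorem detFunctional_sortedChain {A : Type*} {lt : A → A → Prop} {s s' : Finset A} {d : ℕ}
    {v : Fin d → A} (hv : IsEnum lt s v) (h : StrictTotalOn lt s) (h' : StrictTotalOn lt s')
    (hd' : s'.card = d) :
    detFunctional v (sortedChain lt s' d) = if s' = s then 1 else 0 := by
  obtain ⟨x, hx⟩ := h'.exists_isEnum hd'
  rw [hx.sortedChain_eq h', detFunctional, Finsupp.linearCombination_single, one_smul]
  split_ifs with hss
  · subst hss
    obtain rfl := hx.unique hv h'
    rw [← Matrix.det_one (n := Fin d)]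
    congr 1
    ext i j
    simp [Matrix.one_apply, (hx.injective h').eq_iff]
  · have hd : s.card = d := by
      rw [← hv.image, Finset.card_image_of_injective _ (hv.injective h), Finset.card_fin]
    obtain ⟨a, ha, has⟩ : ∃ a ∈ s', a ∉ s := by
      by_contra hcon
      push Not at hcon
      exact hss (Finset.eq_of_subset_of_card_le hcon (by rw [hd, hd']))
    obtain ⟨i, rfl⟩ := hx.exists_eq ha
    refine Matrix.det_eq_zero_of_row_eq_zero i fun j => ?_
    rw [Matrix.of_apply, if_neg]
    exact fun hij => has (hij ▸ hv.mem j)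

/-- The value on the boundary is a Laplace expansion of a determinant with two equal rows, coming
from the repeated vertex. -/
theorem detFunctional_orderedBoundary_single {A : Type*} {d : ℕ} (v : Fin d → A)
    (t : Fin (d + 1) → A) (ht : ¬ Function.Injective t) (k : ℚ) :
    detFunctional v (orderedBoundary A d (Finsupp.single t k)) = 0 := by
  -- The incidence matrix of `t` and `v`, bordered by a first column of ones; deleting row `i` and
  -- this column gives the matrix of the `i`-th face of `t`.
  let M : Matrix (Fin (d + 1)) (Fin (d + 1)) ℚ :=
    Matrix.of fun i => Fin.cons 1 fun j => if t i = v j then (1 : ℚ) else 0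
  have hM : M.det = 0 := by
    simp only [Function.Injective, not_forall] at ht
    obtain ⟨i, j, hij, hne⟩ := ht
    refine Matrix.det_zero_of_row_eq hne ?_
    funext k
    simp only [M, Matrix.of_apply, hij]
  rw [Matrix.det_succ_column_zero] at hM
  rw [orderedBoundary, Finsupp.linearCombination_single, map_smul, map_sum]
  refine (congrArg (k • ·) (Eq.trans ?_ hM)).trans (smul_zero k)
  refine Finset.sum_congr rfl fun i _ => ?_
  rw [detFunctional, Finsupp.linearCombination_single, smul_eq_mul]
  simp only [M, Matrix.of_apply, Fin.cons_zero, mul_one]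
  rfl

/-- With at most `d` vertices per simplex, every tuple of length `d + 1` in a simplex has a
repetition. -/
theorem detFunctional_eq_zero_of_mem_orderedBoundaries {A : Type*}
    {K : PreAbstractSimplicialComplex A} {d : ℕ} (hK : ∀ s ∈ K.faces, s.card ≤ d) (v : Fin d → A)
    {c : (Fin d → A) →₀ ℚ} (hc : c ∈ orderedBoundaries K d) : detFunctional v c = 0 := by
  obtain ⟨e, he, rfl⟩ := hc
  have he' : ∀ t ∈ e.support, Finset.univ.image t ∈ K.faces := fun t ht =>
    ((Finsupp.mem_supported ℚ e).1 he ht).resolve_left (Nat.succ_ne_zero d)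
  rw [← e.sum_single, Finsupp.sum, map_sum, map_sum]
  refine Finset.sum_eq_zero fun t ht => detFunctional_orderedBoundary_single v t (fun hinj => ?_) _
  have := hK _ (he' t ht)
  rw [Finset.card_image_of_injective _ hinj, Finset.card_fin] at this
  omega

theorem mem_orderedBoundaries_of_subsingleton {A : Type*} {K : PreAbstractSimplicialComplex A}
    {m : ℕ} (h : Subsingleton (reducedHomology K m)) {c : (Fin m → A) →₀ ℚ}
    (hc : c ∈ orderedCycles K m) : c ∈ orderedBoundaries K m := by
  have := h.elim (Submodule.Quotient.mk ⟨c, hc⟩) 0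
  rw [Submodule.Quotient.mk_eq_zero] at this
  exact this

/-- Two classes in a one-dimensional space are linearly dependent. -/
theorem exists_smul_add_smul_mem_orderedBoundaries {A : Type*}
    {K : PreAbstractSimplicialComplex A} {m : ℕ} (e : reducedHomology K m ≃ₗ[ℚ] ℚ)
    {c c' : (Fin m → A) →₀ ℚ} (hc : c ∈ orderedCycles K m) (hc' : c' ∈ orderedCycles K m) :
    ∃ k k' : ℚ, (k ≠ 0 ∨ k' ≠ 0) ∧ k • c + k' • c' ∈ orderedBoundaries K m := by
  let a : orderedCycles K m := ⟨c, hc⟩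
  let b : orderedCycles K m := ⟨c', hc'⟩
  let f : orderedCycles K m →ₗ[ℚ] ℚ :=
    e.toLinearMap ∘ₗ ((orderedBoundaries K m).submoduleOf (orderedCycles K m)).mkQ
  have key : ∀ x : orderedCycles K m, f x = 0 → x.1 ∈ orderedBoundaries K m := by
    intro x hx
    have h1 := e.map_eq_zero_iff.1 hx
    have h2 : x ∈ (orderedBoundaries K m).submoduleOf (orderedCycles K m) :=
      (Submodule.Quotient.mk_eq_zero _).1 h1
    exact h2
  by_cases h0 : f a = 0
  · refine ⟨1, 0, Or.inl one_ne_zero, ?_⟩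
    rw [one_smul, zero_smul, add_zero]
    exact key a h0
  -- The relation `f b * f a - f a * f b = 0`, nontrivial because `f a ≠ 0`.
  · refine ⟨f b, - f a, Or.inr (neg_ne_zero.2 h0), key (f b • a + (- f a) • b) ?_⟩
    rw [map_add, map_smul, map_smul, smul_eq_mul, smul_eq_mul]
    ring

/-! ### Top-dimensional cycles of links -/

/-- The sign that compares the ordering of `s` with the one that puts the simplex `t` first. -/
def linkSign {A : Type*} (lt : A → A → Prop) (t s : Finset A) : ℚ :=
  ∏ v ∈ s \ t, (-1) ^ (t.filter fun w => lt w v).card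

theorem linkSign_ne_zero {A : Type*} (lt : A → A → Prop) (t s : Finset A) :
    linkSign lt t s ≠ 0 :=
  Finset.prod_ne_zero_iff.2 fun _ _ => pow_ne_zero _ (by norm_num)

/-- The predecessors of `v` in `s` split into those in `t` and those in `s \ t`; the former give
exactly the factor that `linkSign` loses when `v` is erased. Hence incidence numbers in the link and
in the complex differ by a change of signs of the basis. -/
theorem linkSign_mul_pow {A : Type*} (lt : A → A → Prop) {t s : Finset A} (hts : t ⊆ s) {v : A}
    (hv : v ∈ s \ t) :
    linkSign lt t s * (-1) ^ ((s \ t).filter fun w => lt w v).card =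
      linkSign lt t (s.erase v) * (-1) ^ (s.filter fun w => lt w v).card := by
  have h1 : (s.filter fun w => lt w v).card =
      (t.filter fun w => lt w v).card + ((s \ t).filter fun w => lt w v).card := by
    rw [← Finset.card_union_of_disjoint, ← Finset.filter_union,
      Finset.union_sdiff_of_subset hts]
    exact Finset.disjoint_filter_filter Finset.disjoint_sdiff
  have h2 : linkSign lt t s =
      (-1) ^ (t.filter fun w => lt w v).card * linkSign lt t (s.erase v) := by
    rw [linkSign, linkSign, ← Finset.mul_prod_erase _ _ hv, Finset.erase_sdiff_comm]
  have h3 : ((-1 : ℚ) ^ (t.filter fun w => lt w v).card) *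
      (-1) ^ (t.filter fun w => lt w v).card = 1 := by
    rw [← mul_pow]; norm_num
  rw [h1, h2, pow_add]
  ring

theorem LocalOrder.incidence_erase {A : Type*} {K : PreAbstractSimplicialComplex A}
    (o : LocalOrder K) {s : Finset A} {v : A} (hv : v ∈ s) :
    o.incidence s (s.erase v) = (-1) ^ (s.filter fun w => o.lt w v).card := by
  rw [LocalOrder.incidence, Finset.sdiff_erase_self hv, Finset.sum_singleton]

/-- A chain of `n`-simplices of `K` all of which contain `s`, regarded as an ordered chain of the
link of `s`. -/
def linkChain {A : Type*} {K : PreAbstractSimplicialComplex A} (o : LocalOrder K) {n : ℕ}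
    (s : Finset A) (d : ℕ) (a : Simplex K ⊥ n →₀ ℚ) : (Fin d → A) →₀ ℚ :=
  a.sum fun τ c => (c * linkSign o.lt s τ.1) • sortedChain o.lt (τ.1 \ s) d

/-- The boundary of the chain `a` of `n`-simplices has coefficient `0` at all `(n-1)`-simplices that
contain `s`, and all simplices of `a` contain `s`. -/
structure IsStarCycle {A : Type*} {K : PreAbstractSimplicialComplex A} (o : LocalOrder K) {n : ℕ}
    (s : Finset A) (a : Simplex K ⊥ n →₀ ℚ) : Prop where
  subset : ∀ τ, a τ ≠ 0 → s ⊆ τ.1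
  cycle : ∀ ρ ∈ K.faces, s ⊆ ρ → ρ.card = n →
    (a.sum fun τ c => if ρ ⊆ τ.1 then c * (o.incidence τ.1 ρ : ℚ) else 0) = 0

section

variable {A : Type*} {K : PreAbstractSimplicialComplex A} (o : LocalOrder K) {n d : ℕ}
  {s : Finset A} {a : Simplex K ⊥ n →₀ ℚ}

theorem card_sdiff_of_card_add {τ : Simplex K ⊥ n} (hd : d + s.card = n + 1) (h : s ⊆ τ.1) :
    (τ.1 \ s).card = d := by
  rw [Finset.card_sdiff_of_subset h, τ.2.2.1]
  omega

theorem linkChain_mem_orderedChains (hd : d + s.card = n + 1)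
    (ha : ∀ τ, a τ ≠ 0 → s ⊆ τ.1) :
    linkChain o s d a ∈ orderedChains (simplicialLink K s) d := by
  refine Submodule.sum_mem _ fun τ hτ => Submodule.smul_mem _ _ ?_
  have hs := ha τ (Finsupp.mem_support_iff.1 hτ)
  have hst := (o.strictTotalOn τ.2.1).mono (Finset.sdiff_subset (s := τ.1) (t := s))
  have hcard := card_sdiff_of_card_add hd hs
  obtain ⟨x, hx⟩ := hst.exists_isEnum hcard
  rw [hx.sortedChain_eq hst]
  refine Finsupp.single_mem_supported ℚ _ ?_
  rcases Nat.eq_zero_or_pos d with h0 | h0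
  · exact Or.inl h0
  · refine Or.inr ?_
    rw [hx.image]
    refine ⟨Finset.card_pos.1 (hcard ▸ h0), Finset.disjoint_sdiff, ?_⟩
    rw [Finset.union_sdiff_of_subset hs]
    exact τ.2.1

/-- The faces of `τ \ s` correspond to the codimension one faces `ρ` of `τ` that contain `s`. After
exchanging sums, the coefficient at `ρ \ s` is, up to the sign of `ρ`, the boundary coefficient of
`a` at `ρ`, which is zero. -/
theorem orderedBoundary_linkChain (hs : s ∈ K.faces) (hd : (d + 1) + s.card = n + 1)
    (ha : IsStarCycle o s a) : orderedBoundary A d (linkChain o s (d + 1) a) = 0 := by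
  let G : Simplex K ⊥ n → Finset A → ((Fin d → A) →₀ ℚ) := fun τ ρ =>
    (a τ * (o.incidence τ.1 ρ : ℚ)) • (linkSign o.lt s ρ • sortedChain o.lt (ρ \ s) d)
  -- A finite index set independent of `τ`, so that the two sums can be exchanged.
  let R : Finset (Finset A) :=
    (a.support.biUnion fun τ => τ.1.powerset).filter fun ρ => s ⊆ ρ ∧ ρ.card = n
  have h1 : ∀ τ ∈ a.support,
      orderedBoundary A d ((a τ * linkSign o.lt s τ.1) • sortedChain o.lt (τ.1 \ s) (d + 1)) =
        ∑ ρ ∈ R, if ρ ⊆ τ.1 then G τ ρ else 0 := by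
    intro τ hτ
    have hsub := ha.subset τ (Finsupp.mem_support_iff.1 hτ)
    have hst := (o.strictTotalOn τ.2.1).mono (Finset.sdiff_subset (s := τ.1) (t := s))
    rw [map_smul, orderedBoundary_sortedChain hst (card_sdiff_of_card_add hd hsub),
      Finset.smul_sum, ← Finset.sum_filter]
    refine Finset.sum_bij (fun v _ => τ.1.erase v) ?_ ?_ ?_ ?_
    · intro v hv
      obtain ⟨hvτ, hvs⟩ := Finset.mem_sdiff.1 hv
      simp only [R, Finset.mem_filter, Finset.mem_biUnion, Finset.mem_powerset]
      refine ⟨⟨⟨τ, hτ, Finset.erase_subset _ _⟩, ?_, ?_⟩, Finset.erase_subset _ _⟩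
      · exact fun w hw => Finset.mem_erase.2 ⟨fun h => hvs (h ▸ hw), hsub hw⟩
      · rw [Finset.card_erase_of_mem hvτ, τ.2.2.1]
        rfl
    · intro v hv w hw hvw
      exact (Finset.erase_injOn τ.1) (Finset.mem_sdiff.1 hv).1 (Finset.mem_sdiff.1 hw).1 hvw
    · intro ρ hρ
      simp only [R, Finset.mem_filter] at hρ
      obtain ⟨⟨-, hsρ, hcard⟩, hρτ⟩ := hρ
      obtain ⟨v, hv⟩ : ∃ v, τ.1 \ ρ = {v} := Finset.card_eq_one.1 (by
        rw [Finset.card_sdiff_of_subset hρτ, τ.2.2.1, hcard]; omega)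
      have hvm : v ∈ τ.1 \ ρ := hv ▸ Finset.mem_singleton_self v
      obtain ⟨hvτ, hvρ⟩ := Finset.mem_sdiff.1 hvm
      refine ⟨v, Finset.mem_sdiff.2 ⟨hvτ, fun h => hvρ (hsρ h)⟩, ?_⟩
      rw [← Finset.sdiff_singleton_eq_erase, ← hv, Finset.sdiff_sdiff_eq_self hρτ]
    · intro v hv
      have hvτ := (Finset.mem_sdiff.1 hv).1
      simp only [G]
      rw [smul_smul, smul_smul, o.incidence_erase hvτ, mul_assoc, linkSign_mul_pow _ hsub hv,
        Finset.erase_sdiff_comm]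
      congr 1
      push_cast
      ring
  rw [linkChain, Finsupp.sum, map_sum, Finset.sum_congr rfl h1, Finset.sum_comm]
  refine Finset.sum_eq_zero fun ρ hρ => ?_
  simp only [R, Finset.mem_filter, Finset.mem_biUnion, Finset.mem_powerset] at hρ
  obtain ⟨⟨τ, -, hρτ⟩, hsρ, hcard⟩ := hρ
  have hρK : ρ ∈ K.faces := (K.isRelLowerSet_faces τ.2.1).2 hρτ
    ((K.isRelLowerSet_faces hs).1.mono hsρ)
  have := ha.cycle ρ hρK hsρ hcard
  rw [Finsupp.sum] at this
  refine (Finset.sum_congr rfl fun τ _ => ?_).trans (Finset.sum_smul.symm.trans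
    ((congrArg (· • (linkSign o.lt s ρ • sortedChain o.lt (ρ \ s) d)) this).trans (zero_smul ℚ _)))
  split_ifs
  · rfl
  · rw [zero_smul]

theorem linkChain_mem_orderedCycles (hs : s ∈ K.faces) (hd : d + s.card = n + 1)
    (ha : IsStarCycle o s a) :
    linkChain o s d a ∈ orderedCycles (simplicialLink K s) d := by
  cases d with
  | zero => exact linkChain_mem_orderedChains o hd ha.subset
  | succ d =>
    exact ⟨linkChain_mem_orderedChains o hd ha.subset, orderedBoundary_linkChain o hs hd ha⟩

theorem card_le_of_mem_simplicialLink (hK : ∀ s ∈ K.faces, s.card ≤ n + 1)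
    (hd : d + s.card = n + 1) {t : Finset A} (ht : t ∈ (simplicialLink K s).faces) :
    t.card ≤ d := by
  have := hK _ ht.2.2
  rw [Finset.card_union_of_disjoint ht.2.1] at this
  omega

/-- Take `v` to enumerate `τ \ s`. A simplex containing `s` is determined by its vertices outside
`s`, so every other term is killed. The same `v` serves for all chains `a`. -/
theorem exists_detFunctional_linkChain (hd : d + s.card = n + 1) (τ : Simplex K ⊥ n)
    (hτ : s ⊆ τ.1) :
    ∃ v : Fin d → A, ∀ a : Simplex K ⊥ n →₀ ℚ, (∀ τ, a τ ≠ 0 → s ⊆ τ.1) →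
      detFunctional v (linkChain o s d a) = a τ * linkSign o.lt s τ.1 := by
  have hst : ∀ τ : Simplex K ⊥ n, StrictTotalOn o.lt (τ.1 \ s) := fun τ =>
    (o.strictTotalOn τ.2.1).mono Finset.sdiff_subset
  obtain ⟨v, hv⟩ := (hst τ).exists_isEnum (card_sdiff_of_card_add hd hτ)
  refine ⟨v, fun a ha => ?_⟩
  rw [linkChain, Finsupp.sum, map_sum, Finset.sum_eq_single τ]
  · rw [map_smul, detFunctional_sortedChain hv (hst τ) (hst τ) (card_sdiff_of_card_add hd hτ),
      if_pos rfl, smul_eq_mul, mul_one]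
  · intro τ' hτ' hne
    have hsub := ha τ' (Finsupp.mem_support_iff.1 hτ')
    rw [map_smul, detFunctional_sortedChain hv (hst τ) (hst τ') (card_sdiff_of_card_add hd hsub),
      if_neg, smul_zero]
    intro heq
    refine hne (Subtype.ext ?_)
    rw [← Finset.union_sdiff_of_subset hsub, heq, Finset.union_sdiff_of_subset hτ]
  · intro hτ'
    rw [Finsupp.notMem_support_iff.1 hτ', zero_mul, zero_smul, map_zero]

/-- If the link of `s` has the homology of a point, then there are no cycles in the open star. -/
theorem IsStarCycle.eq_zero (hK : ∀ s ∈ K.faces, s.card ≤ n + 1) (hs : s ∈ K.faces)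
    (h : HasPointHomology (simplicialLink K s)) (ha : IsStarCycle o s a) : a = 0 := by
  ext τ
  by_contra h0
  obtain ⟨d, hd⟩ : ∃ d, d + s.card = n + 1 := ⟨_, Nat.sub_add_cancel (hK s hs)⟩
  obtain ⟨v, hv⟩ := exists_detFunctional_linkChain o hd τ (ha.subset τ h0)
  have h1 := detFunctional_eq_zero_of_mem_orderedBoundaries
    (fun t ht => card_le_of_mem_simplicialLink hK hd ht) v
    (mem_orderedBoundaries_of_subsingleton (h d) (linkChain_mem_orderedCycles o hs hd ha))
  rw [hv a ha.subset] at h1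
  exact (mul_ne_zero h0 (linkSign_ne_zero _ _ _)) h1

/-- If the link of `s` has the homology of a sphere, then any two cycles in the open star are
proportional. -/
theorem IsStarCycle.exists_proportional {b : Simplex K ⊥ n →₀ ℚ}
    (hK : ∀ s ∈ K.faces, s.card ≤ n + 1) (hs : s ∈ K.faces) (hd : d + s.card = n + 1)
    (h : HasSphereHomology (simplicialLink K s) d) (ha : IsStarCycle o s a)
    (hb : IsStarCycle o s b) :
    ∃ k k' : ℚ, (k ≠ 0 ∨ k' ≠ 0) ∧ ∀ τ : Simplex K ⊥ n, s ⊆ τ.1 → k * a τ + k' * b τ = 0 := by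
  obtain ⟨⟨e⟩, -⟩ := h
  obtain ⟨k, k', hk, hmem⟩ := exists_smul_add_smul_mem_orderedBoundaries e
    (linkChain_mem_orderedCycles o hs hd ha) (linkChain_mem_orderedCycles o hs hd hb)
  refine ⟨k, k', hk, fun τ hτ => ?_⟩
  obtain ⟨v, hv⟩ := exists_detFunctional_linkChain o hd τ hτ
  have h1 := detFunctional_eq_zero_of_mem_orderedBoundaries
    (fun t ht => card_le_of_mem_simplicialLink hK hd ht) v hmem
  rw [map_add, map_smul, map_smul, hv a ha.subset, hv b hb.subset, smul_eq_mul, smul_eq_mul,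
    ← mul_assoc, ← mul_assoc, ← add_mul] at h1
  exact (mul_eq_zero.1 h1).resolve_right (linkSign_ne_zero _ _ _)

end

/-! ### Purity of rational homology manifolds -/

/-- Index `0` is degree `-1`: without vertices there are no chains that could bound the empty tuple.
-/
theorem not_subsingleton_reducedHomology_zero {A : Type*} {K : PreAbstractSimplicialComplex A}
    (hK : K.faces = ∅) : ¬ Subsingleton (reducedHomology K 0) := by
  intro h
  have hc : Finsupp.single (default : Fin 0 → A) (1 : ℚ) ∈ orderedCycles K 0 :=
    Finsupp.single_mem_supported ℚ _ (Or.inl rfl)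
  obtain ⟨e, he, hec⟩ := mem_orderedBoundaries_of_subsingleton h hc
  have he0 : e = 0 := by
    ext t
    by_contra h0
    have := ((Finsupp.mem_supported ℚ e).1 he (Finsupp.mem_support_iff.2 h0)).resolve_left
      one_ne_zero
    rw [hK] at this
    exact this
  rw [he0, map_zero] at hec
  have := DFunLike.congr_fun hec default
  rw [Finsupp.single_eq_same] at this
  exact zero_ne_one this

/-- Purity: a maximal simplex has empty link, whose homology in degree `-1` is nonzero. This
excludes the homology of a point and that of spheres of dimension at least `0`, so the maximal
simplex has dimension `n`. -/
theorem IsRatHomologyManifold.exists_superset {A : Type*} {K L : PreAbstractSimplicialComplex A}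
    {n : ℕ} (h : IsRatHomologyManifold K L n) (hfin : K.faces.Finite) {s : Finset A}
    (hs : s ∈ K.faces) : ∃ τ ∈ K.faces, s ⊆ τ ∧ τ.card = n + 1 := by
  obtain ⟨τ, hsτ, hτ⟩ := hfin.exists_le_maximal hs
  -- A simplex of the link would enlarge `τ`.
  have hlink : (simplicialLink K τ).faces = ∅ := by
    refine Set.eq_empty_of_forall_notMem fun t ht => ?_
    obtain ⟨hne, hdisj, hmem⟩ := ht
    have := hτ.le_of_ge hmem Finset.subset_union_left
    obtain ⟨x, hx⟩ := hne
    exact Finset.disjoint_left.1 hdisj (this (Finset.mem_union_right _ hx)) hx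
  refine ⟨τ, hτ.prop, hsτ, ?_⟩
  have h0 := not_subsingleton_reducedHomology_zero hlink
  by_cases hL : τ ∈ L.faces
  · exact (h0 (h.boundary τ hL 0)).elim
  · obtain ⟨d, hd, hsph⟩ := h.interior τ hτ.prop hL
    rcases Nat.eq_zero_or_pos d with rfl | hpos
    · omega
    · exact (h0 (hsph.2 0 hpos.ne)).elim

theorem IsRatHomologyManifold.card_le {A : Type*} {K L : PreAbstractSimplicialComplex A}
    {n : ℕ} (h : IsRatHomologyManifold K L n) (hfin : K.faces.Finite) {s : Finset A}
    (hs : s ∈ K.faces) : s.card ≤ n + 1 := by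
  obtain ⟨τ, -, hsτ, hcard⟩ := h.exists_superset hfin hs
  exact hcard ▸ Finset.card_le_card hsτ

/-! ### A formula for the duality map -/

theorem initialPart_subset {A : Type*} (lt : A → A → Prop) (s : Finset A) (q : ℕ) :
    initialPart lt s q ⊆ s :=
  Finset.filter_subset _ _

theorem initialPart_image {A B : Type*} {lt : A → A → Prop} {lt' : B → B → Prop} {f : A → B}
    {s : Finset A} (hf : Set.InjOn f s)
    (h : ∀ a ∈ s, ∀ b ∈ s, lt' (f a) (f b) ↔ lt a b) (q : ℕ) :
    initialPart lt' (s.image f) q = (initialPart lt s q).image f := by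
  have hc : ∀ a ∈ s, ((s.image f).filter fun w => lt' w (f a)).card =
      (s.filter fun w => lt w a).card := by
    intro a ha
    rw [Finset.filter_image, Finset.card_image_of_injOn
      (hf.mono fun b hb => (Finset.mem_filter.1 hb).1)]
    exact congrArg Finset.card (Finset.filter_congr fun b hb => h b hb a ha)
  rw [initialPart, initialPart, Finset.filter_image]
  exact congrArg (Finset.image f) (Finset.filter_congr fun a ha => by rw [hc a ha])

/-- The value of a function on the simplices of `K` not in `L` at a set of vertices, which is `0`
if this set is not such a simplex. -/
def simplexEval {A : Type*} {K L : PreAbstractSimplicialComplex A} {p : ℕ}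
    (a : Ell2 (Simplex K L p)) (s : Finset A) : ℂ :=
  if h : s ∈ K.faces ∧ s.card = p + 1 ∧ s ∉ L.faces then a ⟨s, h⟩ else 0

theorem simplexEval_coe {A : Type*} {K L : PreAbstractSimplicialComplex A} {p : ℕ}
    (a : Ell2 (Simplex K L p)) (s : Simplex K L p) : simplexEval a s.1 = a s := by
  rw [simplexEval, dif_pos s.2]

theorem simplexEval_of_mem {A : Type*} {K L : PreAbstractSimplicialComplex A} {p : ℕ}
    (a : Ell2 (Simplex K L p)) {s : Finset A} (hs : s ∈ L.faces) : simplexEval a s = 0 := by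
  rw [simplexEval, dif_neg fun h => h.2.2 hs]

/-- Evaluation at a point. -/
def Ell2.eval {I : Type*} (i : I) : Ell2 I →+ ℂ where
  toFun v := v i
  map_zero' := rfl
  map_add' _ _ := rfl

namespace CoveredPair

variable {Γ π A B C : Type*} [Group Γ] [Group π] (T : CoveredPair Γ π A B C) {n p q : ℕ}

/-- The local ordering of the vertices of `Xb` lifted from `X`. -/
def orderB (o : LocalOrder T.X) : LocalOrder T.Xb :=
  o.comap T.q T.covering.nondegenerate

theorem eq_of_image_eq_of_subset {s s' t : Finset B} (hs : s ∈ T.Xb.faces) (hs' : s' ∈ T.Xb.faces)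
    (h : s.image T.q = s'.image T.q) (ht : t.Nonempty) (hts : t ⊆ s) (hts' : t ⊆ s') : s = s' := by
  obtain ⟨b, hb⟩ := ht
  exact eq_of_image_eq T.covering hs hs' h (hts hb) (hts' hb)

/-- The coefficient at the `q`-simplex `t` of the cap product of the function `a` on `p`-simplices
with the `n`-simplex `s` of `X`. It is the value of `a` at the back face of the `n`-simplex of `Xb`
over `s` with front face `t`, if there is one. -/
def capCoeff (o : LocalOrder T.X) (a : Ell2 (Simplex T.Xb T.Lb p))
    (t : Simplex T.Xb T.Lb q) (s : Finset A) : ℂ :=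
  if h : ∃ τ ∈ T.Xb.faces, τ.image T.q = s ∧ initialPart (T.orderB o).lt τ q = t.1 then
    simplexEval a (initialPart (fun b c => (T.orderB o).lt c b) h.choose p) else 0

/-- Two lifts of the same simplex that share the face `t` coincide, so the choice in `capCoeff` is
harmless. -/
theorem capCoeff_eq (o : LocalOrder T.X) (a : Ell2 (Simplex T.Xb T.Lb p))
    (t : Simplex T.Xb T.Lb q) {τ : Finset B} (hτ : τ ∈ T.Xb.faces)
    (hq : initialPart (T.orderB o).lt τ q = t.1) :
    T.capCoeff o a t (τ.image T.q) =
      simplexEval a (initialPart (fun b c => (T.orderB o).lt c b) τ p) := by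
  have hex : ∃ τ' ∈ T.Xb.faces, τ'.image T.q = τ.image T.q ∧
      initialPart (T.orderB o).lt τ' q = t.1 := ⟨τ, hτ, rfl, hq⟩
  rw [capCoeff, dif_pos hex]
  obtain ⟨h1, h2, h3⟩ := hex.choose_spec
  have := T.eq_of_image_eq_of_subset h1 hτ h2 (T.Xb.isRelLowerSet_faces t.2.1).1
    (h3.symm.le.trans (initialPart_subset _ _ _)) (hq.symm.le.trans (initialPart_subset _ _ _))
  rw [this]

theorem capCoeff_of_not (o : LocalOrder T.X) (a : Ell2 (Simplex T.Xb T.Lb p))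
    (t : Simplex T.Xb T.Lb q) {s : Finset A}
    (h : ¬ ∃ τ ∈ T.Xb.faces, τ.image T.q = s ∧ initialPart (T.orderB o).lt τ q = t.1) :
    T.capCoeff o a t s = 0 :=
  dif_neg h

/-- The lifted local ordering is invariant under deck transformations. -/
theorem orderB_lt_act (o : LocalOrder T.X) (g : Γ) {c d : C} (hc : {c} ∈ T.Xt.faces)
    (hd : {d} ∈ T.Xt.faces) :
    (T.orderB o).lt (T.ρ g (T.p c)) (T.ρ g (T.p d)) ↔ (T.orderT o).lt c d := by
  have h : ∀ {c}, {c} ∈ T.Xt.faces → T.q (T.ρ g (T.p c)) = T.q (T.p c) := fun {c} hc =>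
    T.covering.act_over g _ (by
      have := (T.p_nondegenerate _ hc).1
      rwa [Finset.image_singleton] at this)
  change o.lt _ _ ↔ o.lt _ _
  rw [h hc, h hd]
  rfl

theorem injOn_act_p (g : Γ) {σ : Finset C} (hσ : σ ∈ T.Xt.faces) :
    Set.InjOn (fun c => T.ρ g (T.p c)) σ := fun _ hc _ hd h =>
  (T.p_nondegenerate σ hσ).2 hc hd ((T.ρ g).injective h)

theorem initialPart_orderB_act (o : LocalOrder T.X) (g : Γ) {σ : Finset C}
    (hσ : σ ∈ T.Xt.faces) (q : ℕ) :
    initialPart (T.orderB o).lt (σ.image fun c => T.ρ g (T.p c)) q =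
      (initialPart (T.orderT o).lt σ q).image fun c => T.ρ g (T.p c) :=
  initialPart_image (T.injOn_act_p g hσ)
    (fun _ ha _ hb => T.orderB_lt_act o g (vertex_mem hσ ha) (vertex_mem hσ hb)) q

theorem initialPart_swap_orderB_act (o : LocalOrder T.X) (g : Γ) {σ : Finset C}
    (hσ : σ ∈ T.Xt.faces) (p : ℕ) :
    initialPart (fun b c => (T.orderB o).lt c b) (σ.image fun c => T.ρ g (T.p c)) p =
      (initialPart (fun b c => (T.orderT o).lt c b) σ p).image fun c => T.ρ g (T.p c) :=
  initialPart_image (T.injOn_act_p g hσ) (by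
    intro a ha b hb
    exact T.orderB_lt_act o g (vertex_mem hσ hb) (vertex_mem hσ ha)) p

theorem image_act_p_mem (g : Γ) {σ : Finset C} (hσ : σ ∈ T.Xt.faces) :
    (σ.image fun c => T.ρ g (T.p c)) ∈ T.Xb.faces := by
  have := T.covering.act_mem g _ (T.p_nondegenerate σ hσ).1
  rwa [Finset.image_image] at this

theorem image_q_image_act_p (g : Γ) {σ : Finset C} (hσ : σ ∈ T.Xt.faces) :
    (σ.image fun c => T.ρ g (T.p c)).image T.q = σ.image (T.q ∘ T.p) := by
  have := image_act T.covering g (T.p_nondegenerate σ hσ).1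
  simp only [Finset.image_image] at this ⊢
  exact this

theorem image_act_p_mem_Lb_iff (g : Γ) {σ : Finset C} (hσ : σ ∈ T.Xt.faces) :
    (σ.image fun c => T.ρ g (T.p c)) ∈ T.Lb.faces ↔ σ ∈ T.Lt.faces := by
  rw [T.mem_Lb, T.mem_Lt, T.image_q_image_act_p g hσ]
  exact and_congr_left fun _ => iff_of_true (T.image_act_p_mem g hσ) hσ

theorem actB_projB_coe (g : Γ) (σ : Simplex T.Xt T.Lt p) :
    (T.actB g (T.projB σ)).1 = σ.1.image fun c => T.ρ g (T.p c) := by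
  simp only [actB, projB, Simplex.map, Finset.image_image]
  rfl

/-- The simplices of `Xb` over a given simplex of `X` form an orbit. -/
theorem exists_act_eq {σ : Finset C} (hσ : σ ∈ T.Xt.faces) {τ : Finset B} (hτ : τ ∈ T.Xb.faces)
    (h : τ.image T.q = σ.image (T.q ∘ T.p)) : ∃ g, (σ.image fun c => T.ρ g (T.p c)) = τ := by
  obtain ⟨c, hc⟩ := (T.Xt.isRelLowerSet_faces hσ).1
  have : (T.q ∘ T.p) c ∈ τ.image T.q := h ▸ Finset.mem_image_of_mem _ hc
  obtain ⟨b, hb, hbc⟩ := Finset.mem_image.1 this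
  obtain ⟨g, hg, -⟩ := T.covering.simplyTransitive (T.p c) b
    (vertex_mem (T.p_nondegenerate σ hσ).1 (Finset.mem_image_of_mem _ hc)) (vertex_mem hτ hb)
    hbc.symm
  refine ⟨g, eq_of_image_eq T.covering (T.image_act_p_mem g hσ) hτ
    ((T.image_q_image_act_p g hσ).trans h.symm) (b := b) ?_ hb⟩
  exact hg ▸ Finset.mem_image_of_mem (fun c => T.ρ g (T.p c)) hc

theorem toRelative_single_of_mem {σ : Simplex T.absolute.Xt T.absolute.Lt p}
    (h : σ.1 ∈ T.Lt.faces) : T.toRelative p (Finsupp.single σ 1) = 0 := by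
  rw [toRelative, Finsupp.linearCombination_single, one_smul, dif_pos h]

theorem toRelative_single_of_notMem {σ : Simplex T.absolute.Xt T.absolute.Lt p}
    (h : σ.1 ∉ T.Lt.faces) : T.toRelative p (Finsupp.single σ 1) =
      Finsupp.single (⟨σ.1, σ.2.1, σ.2.2.1, h⟩ : Simplex T.Xt T.Lt p) 1 := by
  rw [toRelative, Finsupp.linearCombination_single, one_smul, dif_neg h]

/-- The conjugation and the inversion of `g` in `funCochain` are undone by the involution in the cap
product. Simplices in `Lt` give `0` on both sides: the relative chain vanishes, and so does
`simplexEval` over `Lb`. -/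
theorem inv_funCochain_apply (a : Ell2 (Simplex T.Xb T.Lb p))
    (σ : Simplex T.absolute.Xt T.absolute.Lt p) (g : Γ) :
    Ell2.inv ((T.funCochain a).1 (T.toRelative p (Finsupp.single σ 1))) g =
      simplexEval a (σ.1.image fun c => T.ρ g (T.p c)) := by
  have hσ : σ.1 ∈ T.Xt.faces := σ.2.1
  by_cases h : σ.1 ∈ T.Lt.faces
  · rw [toRelative_single_of_mem T h, map_zero, map_zero,
      simplexEval_of_mem a ((T.image_act_p_mem_Lb_iff g hσ).2 h)]
    rfl
  · rw [toRelative_single_of_notMem T h, ← T.actB_projB_coe g ⟨σ.1, σ.2.1, σ.2.2.1, h⟩,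
      simplexEval_coe]
    change conj ((T.funCochain a).1 (Finsupp.single _ 1) g⁻¹) = _
    rw [funCochain_single, Complex.conj_conj, inv_inv]

/-- The simplices of `Xb` over a given `n`-simplex are the translates by `g` of the image of one
lift `σ`. The translate with front face `t`, if it exists, contributes the coefficient of `g`, which
is the value of `a` at its back face. -/
theorem chainToFun_cap_term (o : LocalOrder T.X) (hp : p ≤ n) (hq : q ≤ n)
    (a : Ell2 (Simplex T.Xb T.Lb p)) (t : Simplex T.Xb T.Lb q)
    (σ : Simplex T.absolute.Xt T.absolute.Lt n) :
    T.tensorToFun q (Ell2.inv ((T.funCochain a).1 (T.toRelative p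
        (Finsupp.single ((T.orderT o).back hp σ) 1))) ⊗ₜ[ℤ]
        T.toRelative q (Finsupp.single ((T.orderT o).front hq σ) 1)) t =
      T.capCoeff o a t (σ.1.image (T.q ∘ T.p)) := by
  have hσ : σ.1 ∈ T.Xt.faces := σ.2.1
  have hf : initialPart (T.orderT o).lt σ.1 q ∈ T.Xt.faces := ((T.orderT o).front hq σ).2.1
  by_cases hex : ∃ τ ∈ T.Xb.faces, τ.image T.q = σ.1.image (T.q ∘ T.p) ∧
      initialPart (T.orderB o).lt τ q = t.1
  · obtain ⟨τ, hτ, hτσ, hτt⟩ := hex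
    obtain ⟨g, rfl⟩ := T.exists_act_eq hσ hτ hτσ
    have hft : ((initialPart (T.orderT o).lt σ.1 q).image fun c => T.ρ g (T.p c)) = t.1 := by
      rw [← hτt, T.initialPart_orderB_act o g hσ]
    have hnot : ((T.orderT o).front hq σ).1 ∉ T.Lt.faces := fun h =>
      t.2.2.2 (hft ▸ (T.image_act_p_mem_Lb_iff g hf).2 h)
    rw [toRelative_single_of_notMem T hnot, tensorToFun_single, one_smul]
    have ht : T.actB g (T.projB ⟨((T.orderT o).front hq σ).1, ((T.orderT o).front hq σ).2.1,
        ((T.orderT o).front hq σ).2.2.1, hnot⟩) = t :=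
      Subtype.ext ((T.actB_projB_coe g _).trans hft)
    rw [← T.image_q_image_act_p g hσ, T.capCoeff_eq o a t hτ hτt,
      T.initialPart_swap_orderB_act o g hσ]
    conv_lhs => rw [← ht]
    rw [orbitMap_apply_act, inv_funCochain_apply]
    rfl
  · rw [T.capCoeff_of_not o a t hex]
    by_cases hL : ((T.orderT o).front hq σ).1 ∈ T.Lt.faces
    · rw [toRelative_single_of_mem T hL, TensorProduct.tmul_zero, map_zero]
      rfl
    · rw [toRelative_single_of_notMem T hL, tensorToFun_single, one_smul, orbitMap_apply_of_not]
      rintro ⟨g, hg⟩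
      refine hex ⟨_, T.image_act_p_mem g hσ, T.image_q_image_act_p g hσ, ?_⟩
      rw [T.initialPart_orderB_act o g hσ, ← hg, actB_projB_coe]
      rfl

theorem duality_apply (o : LocalOrder T.X) (hpq : p + q = n) (z : IntChain T.X ⊥ n)
    (a : Ell2 (Simplex T.Xb T.Lb p)) (t : Simplex T.Xb T.Lb q) :
    T.duality o hpq z a t = z.sum fun s k => (k : ℂ) * T.capCoeff o a t s.1 := by
  change Ell2.eval t (T.chainToFun q (T.toRelativeL2 q (T.cap o hpq z (T.funCochain a)))) = _
  change Ell2.eval t (T.chainToFun q (T.toRelativeL2 q (z.sum fun s k => k •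
    (T.absolute.balancedRelations q).mkQ
    ((Ell2.inv ((T.funCochain a).1 (T.toRelative p
      (Finsupp.single ((T.orderT o).back (by omega) (T.absolute.liftT s)) 1)))) ⊗ₜ[ℤ]
      Finsupp.single ((T.orderT o).front (by omega) (T.absolute.liftT s)) 1)))) = _
  rw [Finsupp.sum, map_sum, map_sum, map_sum, Finsupp.sum]
  refine Finset.sum_congr rfl fun s _ => ?_
  rw [map_zsmul, map_zsmul, map_zsmul, zsmul_eq_mul]
  congr 1
  refine (T.chainToFun_cap_term o (by omega) (by omega) a t (T.absolute.liftT s)).trans ?_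
  congr 1
  exact congrArg Subtype.val (T.absolute.projT_liftT s)

end CoveredPair

/-! ### Extension by zero -/

section

variable {A : Type*} {U V K L : PreAbstractSimplicialComplex A} {p : ℕ}

theorem extendByZero_apply (a : Ell2 (Simplex U V p)) (s : Simplex K L p) :
    extendByZero U V K L p a s = simplexEval a s.1 := by
  change (dite _ _ _ : Option (Simplex U V p)).elim 0 a = _
  by_cases h : s.1 ∈ U.faces ∧ s.1 ∉ V.faces
  · rw [dif_pos h, simplexEval, dif_pos ⟨h.1, s.2.2.1, h.2⟩]
    rfl
  · rw [dif_neg h, simplexEval, dif_neg fun h' => h ⟨h'.1, h'.2.2⟩]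
    rfl

/-- The inclusion of the simplices of `U` not in `V` into those of `K` not in `L`. -/
def Simplex.incl (h : ∀ s ∈ U.faces, s ∉ V.faces → s ∈ K.faces ∧ s ∉ L.faces)
    (s : Simplex U V p) : Simplex K L p :=
  ⟨s.1, (h s.1 s.2.1 s.2.2.2).1, s.2.2.1, (h s.1 s.2.1 s.2.2.2).2⟩

theorem simplexEval_extendByZero
    (h : ∀ s ∈ U.faces, s ∉ V.faces → s ∈ K.faces ∧ s ∉ L.faces)
    (a : Ell2 (Simplex U V p)) (s : Finset A) :
    simplexEval (extendByZero U V K L p a) s = simplexEval a s := by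
  by_cases hs : s ∈ K.faces ∧ s.card = p + 1 ∧ s ∉ L.faces
  · rw [simplexEval, dif_pos hs, extendByZero_apply]
  · rw [simplexEval, dif_neg hs, simplexEval, dif_neg]
    rintro ⟨h1, h2, h3⟩
    exact hs ⟨(h s h1 h3).1, h2, (h s h1 h3).2⟩

theorem extendByZero_single
    (h : ∀ s ∈ U.faces, s ∉ V.faces → s ∈ K.faces ∧ s ∉ L.faces) (t : Simplex U V p) :
    extendByZero U V K L p (lp.single 2 t 1) = lp.single 2 (Simplex.incl h t) 1 := by
  ext s
  rw [extendByZero_apply, lp.single_apply, simplexEval]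
  by_cases hs : s = Simplex.incl h t
  · subst hs
    rw [Pi.single_eq_same]
    refine (simplexEval_coe (lp.single 2 t (1 : ℂ)) t).trans ?_
    rw [lp.single_apply, Pi.single_eq_same]
  · rw [Pi.single_eq_of_ne hs]
    split_ifs with h'
    · rw [lp.single_apply, Pi.single_eq_of_ne]
      exact fun heq => hs (Subtype.ext (congrArg (fun x : Simplex U V p => x.1) heq))
    · rfl

/-- Pairing with the basis vector at `t` shows that the adjoint is restriction to the simplices of
`U` not in `V`. -/
theorem adjoint_extendByZero_apply
    (h : ∀ s ∈ U.faces, s ∉ V.faces → s ∈ K.faces ∧ s ∉ L.faces)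
    (w : Ell2 (Simplex K L p)) (t : Simplex U V p) :
    ContinuousLinearMap.adjoint (extendByZero U V K L p) w t = w (Simplex.incl h t) := by
  have h1 := ContinuousLinearMap.adjoint_inner_right (extendByZero U V K L p)
    (lp.single 2 t 1) w
  rw [extendByZero_single h, lp.inner_single_left, lp.inner_single_left] at h1
  simpa using h1

/-- Restricting an extension by zero gives back the function, so `P_U` composed with `P_U^*` is the
identity. -/
theorem isometry_extendByZero
    (h : ∀ s ∈ U.faces, s ∉ V.faces → s ∈ K.faces ∧ s ∉ L.faces) :
    Isometry (extendByZero U V K L p) := by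
  refine AddMonoidHomClass.isometry_of_norm _
    ((ContinuousLinearMap.norm_map_iff_adjoint_comp_self _).2 ?_)
  ext a t
  change ContinuousLinearMap.adjoint (extendByZero U V K L p) (extendByZero U V K L p a) t = a t
  rw [adjoint_extendByZero_apply h, extendByZero_apply]
  exact simplexEval_coe a t

end

/-! ### Fundamental cycles in open stars -/

theorem LocalOrder.incidence_image {A B : Type*} {K : PreAbstractSimplicialComplex A}
    {K' : PreAbstractSimplicialComplex B} (o : LocalOrder K') (f : A → B)
    (hf : IsNondegenerate f K K') {s t : Finset A} (hs : s ∈ K.faces) (hts : t ⊆ s) :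
    o.incidence (s.image f) (t.image f) = (o.comap f hf).incidence s t := by
  have hinj := (hf s hs).2
  have hd : s.image f \ t.image f = (s \ t).image f := by
    ext b
    simp only [Finset.mem_sdiff, Finset.mem_image]
    constructor
    · rintro ⟨⟨a, ha, rfl⟩, hb⟩
      exact ⟨a, ⟨ha, fun hat => hb ⟨a, hat, rfl⟩⟩, rfl⟩
    · rintro ⟨a, ⟨ha, hat⟩, rfl⟩
      exact ⟨⟨a, ha, rfl⟩, fun ⟨a', ha', haa⟩ => hat (hinj (hts ha') ha haa ▸ ha')⟩
  rw [LocalOrder.incidence, LocalOrder.incidence, hd,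
    Finset.sum_image (hinj.mono (Finset.coe_subset.2 Finset.sdiff_subset))]
  refine Finset.sum_congr rfl fun v _ => ?_
  rw [Finset.filter_image, Finset.card_image_of_injOn
    (hinj.mono fun b hb => (Finset.mem_filter.1 hb).1)]
  rfl

/-- The part of an integral chain on the simplices with the property `P`, with rational
coefficients. -/
def ratRestrict {A : Type*} {K : PreAbstractSimplicialComplex A} {n : ℕ} (z : IntChain K ⊥ n)
    (P : Finset A → Prop) : Simplex K ⊥ n →₀ ℚ :=
  (z.mapRange (fun k : ℤ => (k : ℚ)) Int.cast_zero).filter fun τ => P τ.1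

section

variable {A : Type*} {K : PreAbstractSimplicialComplex A} {n : ℕ} {z : IntChain K ⊥ n}
  {P : Finset A → Prop}

theorem ratRestrict_of_pos {τ : Simplex K ⊥ n} (h : P τ.1) : ratRestrict z P τ = z τ := by
  rw [ratRestrict, Finsupp.filter_apply_pos (fun τ : Simplex K ⊥ n => P τ.1) _ h,
    Finsupp.mapRange_apply]

theorem ratRestrict_of_neg {τ : Simplex K ⊥ n} (h : ¬ P τ.1) : ratRestrict z P τ = 0 :=
  Finsupp.filter_apply_neg (fun τ : Simplex K ⊥ n => P τ.1) _ h

theorem ratRestrict_ne_zero_iff {τ : Simplex K ⊥ n} :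
    ratRestrict z P τ ≠ 0 ↔ P τ.1 ∧ z τ ≠ 0 := by
  by_cases h : P τ.1
  · rw [ratRestrict_of_pos h, Int.cast_ne_zero]
    exact (and_iff_right h).symm
  · rw [ratRestrict_of_neg h]
    exact iff_of_false (fun h => h rfl) fun h' => h h'.1

theorem IsFundamentalCycle.ne_zero {o : LocalOrder K} {L : PreAbstractSimplicialComplex A}
    (hz : IsFundamentalCycle o L n z) (τ : Simplex K ⊥ n) : z τ ≠ 0 := by
  rcases hz.unit τ with h | h <;> rw [h] <;> norm_num

/-- A simplex that contains a face `ρ ⊇ s` contains `s`, so restriction to the star omits no term of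
the boundary coefficient at `ρ`. Moreover `ρ` is not in `L`, because its face `s` is not. -/
theorem IsFundamentalCycle.isStarCycle {o : LocalOrder K} {L : PreAbstractSimplicialComplex A}
    (hz : IsFundamentalCycle o L n z) {s : Finset A} (hs : s ∈ K.faces) (hsL : s ∉ L.faces) :
    IsStarCycle o s (ratRestrict z fun τ => s ⊆ τ) := by
  refine ⟨fun τ h => (ratRestrict_ne_zero_iff.1 h).1, fun ρ hρ hsρ hcard => ?_⟩
  have h0 := hz.cycle ρ hρ
    (fun h => hsL ((L.isRelLowerSet_faces h).2 hsρ (K.isRelLowerSet_faces hs).1)) hcard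
  have h1 := congrArg (Int.cast : ℤ → ℚ) h0
  rw [Int.cast_zero, Finsupp.sum, Int.cast_sum] at h1
  refine Eq.trans ?_ h1
  rw [Finsupp.sum]
  refine Finset.sum_subset_zero_on_sdiff ?_ ?_ ?_
  · intro τ hτ
    exact Finsupp.mem_support_iff.2 (ratRestrict_ne_zero_iff.1 (Finsupp.mem_support_iff.1 hτ)).2
  · intro τ hτ
    obtain ⟨h2, h3⟩ := Finset.mem_sdiff.1 hτ
    rw [if_neg, Int.cast_zero]
    exact fun hsub => h3 (Finsupp.mem_support_iff.2 (ratRestrict_ne_zero_iff.2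
      ⟨hsρ.trans hsub, Finsupp.mem_support_iff.1 h2⟩))
  · intro τ hτ
    rw [ratRestrict_of_pos (ratRestrict_ne_zero_iff.1 (Finsupp.mem_support_iff.1 hτ)).1]
    split_ifs
    · push_cast
      rfl
    · rw [Int.cast_zero]

end

/-! ### Position of the subcomplex `U` in the covering -/

namespace CoveredPair

variable {Γ π A B C : Type*} [Group Γ] [Group π] (T : CoveredPair Γ π A B C) {n : ℕ}
  {U V : PreAbstractSimplicialComplex B}

/-- `τ` is the image of a simplex of `U` that contains `s`. -/
def IsImageOf (U : PreAbstractSimplicialComplex B) (s : Finset B) (τ : Finset A) : Prop :=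
  ∃ σ ∈ U.faces, s ⊆ σ ∧ σ.image T.q = τ

/-- A face `ρ` of `X` that contains the image of `s` has at most one lift `ρ'` through `s`. The
`n`-simplices counted at `ρ` are therefore the images of those of `U` around `ρ'`, each hit once,
and their signed sum vanishes because `ρ'` is not in `V`. -/
theorem isStarCycle_of_subcomplex {o : LocalOrder T.X} {z : IntChain T.X ⊥ n}
    (hU : U ≤ T.Xb) {zU : IntChain U ⊥ n}
    (hzU : IsFundamentalCycle (o.comap T.q (T.nondegenerate_of_le hU)) V n zU)
    (horient : ∀ s : Simplex U ⊥ n,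
      zU s = z (Simplex.map T.q (T.nondegenerate_of_le hU) (fun _ _ h => h.elim) s))
    {s : Finset B} (hs : s ∈ U.faces) (hsV : s ∉ V.faces) :
    IsStarCycle o (s.image T.q) (ratRestrict z (T.IsImageOf U s)) := by
  have hne : s.Nonempty := (U.isRelLowerSet_faces hs).1
  refine ⟨fun τ h => ?_, fun ρ hρ hsρ hcard => ?_⟩
  · obtain ⟨⟨σ, -, hsσ, hστ⟩, -⟩ := ratRestrict_ne_zero_iff.1 h
    exact hστ ▸ Finset.image_subset_image hsσ
  -- The vertices of `σ` over `ρ` span a lift of `ρ` that is a face of `σ` and contains `s`.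
  · have hface : ∀ σ ∈ U.faces, s ⊆ σ → ρ ⊆ σ.image T.q →
        s ⊆ (σ.filter fun v => T.q v ∈ ρ) ∧ (σ.filter fun v => T.q v ∈ ρ) ∈ U.faces ∧
        (σ.filter fun v => T.q v ∈ ρ).image T.q = ρ := by
      intro σ hσ hsσ hρσ
      have h1 : s ⊆ (σ.filter fun v => T.q v ∈ ρ) := fun v hv =>
        Finset.mem_filter.2 ⟨hsσ hv, hsρ (Finset.mem_image_of_mem _ hv)⟩
      refine ⟨h1, (U.isRelLowerSet_faces hσ).2 (Finset.filter_subset _ _) (hne.mono h1), ?_⟩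
      ext a
      simp only [Finset.mem_image, Finset.mem_filter]
      constructor
      · rintro ⟨v, ⟨-, hv⟩, rfl⟩
        exact hv
      · intro ha
        obtain ⟨v, hv, rfl⟩ := Finset.mem_image.1 (hρσ ha)
        exact ⟨v, ⟨hv, ha⟩, rfl⟩
    by_cases hex : ∃ σ ∈ U.faces, s ⊆ σ ∧ ρ ⊆ σ.image T.q
    · obtain ⟨σ₀, hσ₀, hsσ₀, hρσ₀⟩ := hex
      obtain ⟨hsρ', hρ'U, hρ'⟩ := hface σ₀ hσ₀ hsσ₀ hρσ₀
      set ρ' := σ₀.filter fun v => T.q v ∈ ρ with hρ'_def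
      have hcard' : ρ'.card = n := by
        rw [← hcard, ← hρ', Finset.card_image_of_injOn (T.nondegenerate_of_le hU ρ' hρ'U).2]
      have h0 := hzU.cycle ρ' hρ'U (fun h => hsV ((V.isRelLowerSet_faces h).2 hsρ' hne)) hcard'
      have h1 := congrArg (Int.cast : ℤ → ℚ) h0
      rw [Int.cast_zero, Finsupp.sum, Int.cast_sum] at h1
      refine Eq.trans ?_ h1
      rw [Finsupp.sum]
      have hval : ∀ σ : Simplex U ⊥ n, ρ' ⊆ σ.1 → ratRestrict z (T.IsImageOf U s)
          (Simplex.map T.q (T.nondegenerate_of_le hU) (fun _ _ h => h.elim) σ) = zU σ := by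
        intro σ hσ
        rw [ratRestrict_of_pos ⟨σ.1, σ.2.1, hsρ'.trans hσ, rfl⟩, horient]
      symm
      simp only [apply_ite (Int.cast : ℤ → ℚ), Int.cast_zero]
      rw [← Finset.sum_filter, ← Finset.sum_filter]
      refine Finset.sum_bij (fun σ _ =>
        Simplex.map T.q (T.nondegenerate_of_le hU) (fun _ _ h => h.elim) σ) ?_ ?_ ?_ ?_
      · intro σ hσ
        obtain ⟨hσ1, hσ2⟩ := Finset.mem_filter.1 hσ
        refine Finset.mem_filter.2 ⟨Finsupp.mem_support_iff.2 ?_,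
          hρ' ▸ Finset.image_subset_image hσ2⟩
        rw [hval σ hσ2, Int.cast_ne_zero]
        exact hzU.ne_zero σ
      · intro σ hσ σ' hσ' heq
        exact Subtype.ext (T.eq_of_image_eq_of_subset (hU σ.2.1) (hU σ'.2.1)
          (congrArg Subtype.val heq) (hne.mono hsρ') (Finset.mem_filter.1 hσ).2
          (Finset.mem_filter.1 hσ').2)
      · intro τ hτ
        obtain ⟨hτ1, hτ2⟩ := Finset.mem_filter.1 hτ
        obtain ⟨⟨σ, hσ, hsσ, hστ⟩, -⟩ := ratRestrict_ne_zero_iff.1 (Finsupp.mem_support_iff.1 hτ1)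
        have hσcard : σ.card = n + 1 := by
          rw [← τ.2.2.1, ← hστ, Finset.card_image_of_injOn (T.nondegenerate_of_le hU σ hσ).2]
        obtain ⟨h2, h3, h4⟩ := hface σ hσ hsσ (hστ ▸ hτ2)
        -- The lifts of `ρ` inside `σ` and inside `σ₀` both contain `s`, hence are equal.
        have h5 := T.eq_of_image_eq_of_subset (hU hρ'U) (hU h3) (hρ'.trans h4.symm) hne hsρ' h2
        exact ⟨⟨σ, hσ, hσcard, fun h => h⟩, Finset.mem_filter.2
          ⟨Finsupp.mem_support_iff.2 (hzU.ne_zero _), h5.le.trans (Finset.filter_subset _ _)⟩,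
          Subtype.ext hστ⟩
      · intro σ hσ
        have hσ2 := (Finset.mem_filter.1 hσ).2
        rw [hval σ hσ2, Int.cast_mul, ← hρ']
        congr 2
        exact (o.incidence_image T.q (T.nondegenerate_of_le hU) σ.2.1 hσ2).symm
    · refine Finset.sum_eq_zero fun τ hτ => if_neg fun hρτ => ?_
      obtain ⟨⟨σ, hσ, hsσ, hστ⟩, -⟩ := ratRestrict_ne_zero_iff.1 (Finsupp.mem_support_iff.1 hτ)
      exact hex ⟨σ, hσ, hsσ, hστ ▸ hρτ⟩

variable {T} {o : LocalOrder T.X} {z : IntChain T.X ⊥ n} {zU : IntChain U ⊥ n}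

/-- Purity of `U` provides an `n`-simplex around `s`; it shows that the cycle coming from `U` is not
zero. -/
theorem exists_isImageOf (hz : IsFundamentalCycle o T.L n z) (hU : U ≤ T.Xb)
    (hUfin : U.faces.Finite) (hUV : IsRatHomologyManifold U V n) {s : Finset B} (hs : s ∈ U.faces) :
    ∃ τ : Simplex T.X ⊥ n, T.IsImageOf U s τ.1 ∧ z τ ≠ 0 := by
  obtain ⟨σ, hσ, hsσ, hcard⟩ := hUV.exists_superset hUfin hs
  refine ⟨⟨σ.image T.q, (T.nondegenerate_of_le hU σ hσ).1, ?_, fun h => h⟩,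
    ⟨σ, hσ, hsσ, rfl⟩, hz.ne_zero _⟩
  rw [Finset.card_image_of_injOn (T.nondegenerate_of_le hU σ hσ).2, hcard]

/-- An interior simplex of `U` is an interior simplex of `Xb`. -/
theorem image_notMem_L
    (hX : IsRatHomologyManifold T.X T.L n)
    (hz : IsFundamentalCycle o T.L n z) (hU : U ≤ T.Xb) (hUfin : U.faces.Finite)
    (hUV : IsRatHomologyManifold U V n)
    (hzU : IsFundamentalCycle (o.comap T.q (T.nondegenerate_of_le hU)) V n zU)
    (horient : ∀ s : Simplex U ⊥ n,
      zU s = z (Simplex.map T.q (T.nondegenerate_of_le hU) (fun _ _ h => h.elim) s))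
    {s : Finset B} (hs : s ∈ U.faces) (hsV : s ∉ V.faces) :
    s.image T.q ∉ T.L.faces := by
  intro hL
  have h0 := IsStarCycle.eq_zero o (fun _ h => hX.card_le T.finite h)
    (T.nondegenerate_of_le hU s hs).1 (hX.boundary _ hL)
    (T.isStarCycle_of_subcomplex hU hzU horient hs hsV)
  obtain ⟨τ, hτ⟩ := exists_isImageOf hz hU hUfin hUV hs
  exact ratRestrict_ne_zero_iff.2 hτ (DFunLike.congr_fun h0 τ)

/-- All `n`-simplices of `Xb` that contain an interior simplex of `U` belong to `U`. -/
theorem mem_of_subset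
    (hX : IsRatHomologyManifold T.X T.L n)
    (hz : IsFundamentalCycle o T.L n z) (hU : U ≤ T.Xb) (hUfin : U.faces.Finite)
    (hUV : IsRatHomologyManifold U V n)
    (hzU : IsFundamentalCycle (o.comap T.q (T.nondegenerate_of_le hU)) V n zU)
    (horient : ∀ s : Simplex U ⊥ n,
      zU s = z (Simplex.map T.q (T.nondegenerate_of_le hU) (fun _ _ h => h.elim) s))
    {s τ : Finset B} (hs : s ∈ U.faces) (hsV : s ∉ V.faces)
    (hτ : τ ∈ T.Xb.faces) (hcard : τ.card = n + 1) (hsτ : s ⊆ τ) : τ ∈ U.faces := by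
  have hL := image_notMem_L hX hz hU hUfin hUV hzU horient hs hsV
  have hsX := (T.nondegenerate_of_le hU s hs).1
  obtain ⟨d, hd, hsph⟩ := hX.interior _ hsX hL
  -- `k` belongs to the cycle coming from `U`, `k'` to the full fundamental cycle around the image
  -- of `s`.
  obtain ⟨k, k', hk, hkk⟩ := IsStarCycle.exists_proportional o
    (fun _ h => hX.card_le T.finite h) hsX hd hsph
    (T.isStarCycle_of_subcomplex hU hzU horient hs hsV) (hz.isStarCycle hsX hL)
  obtain ⟨τ₀, ⟨σ₀, hσ₀, hsσ₀, hστ₀⟩, hzτ₀⟩ := exists_isImageOf hz hU hUfin hUV hs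
  have hsub₀ : s.image T.q ⊆ τ₀.1 := hστ₀ ▸ Finset.image_subset_image hsσ₀
  have h1 := hkk τ₀ hsub₀
  -- Both cycles have the coefficient `z τ₀` at a simplex coming from `U`, whence `k + k' = 0`.
  rw [ratRestrict_of_pos ⟨σ₀, hσ₀, hsσ₀, hστ₀⟩, ratRestrict_of_pos hsub₀, ← add_mul] at h1
  have h2 := (mul_eq_zero.1 h1).resolve_right (Int.cast_ne_zero.2 hzτ₀)
  let τ₁ : Simplex T.X ⊥ n := ⟨τ.image T.q, (T.covering.nondegenerate τ hτ).1, by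
    rw [Finset.card_image_of_injOn (T.covering.nondegenerate τ hτ).2, hcard], fun h => h⟩
  have hsub₁ : s.image T.q ⊆ τ₁.1 := Finset.image_subset_image hsτ
  have h3 := hkk τ₁ hsub₁
  by_cases him : T.IsImageOf U s τ₁.1
  · obtain ⟨σ, hσ, hsσ, hστ⟩ := him
    -- `τ` and `σ` lie over the same simplex and share `s`, so they are equal.
    rwa [T.eq_of_image_eq_of_subset hτ (hU hσ) hστ.symm (U.isRelLowerSet_faces hs).1 hsτ hsσ]
  -- If `τ₁` does not come from `U`, only the full cycle has a coefficient there. This forces `k' =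
  -- 0`, hence `k = 0`, a contradiction.
  · rw [ratRestrict_of_neg him, ratRestrict_of_pos hsub₁, mul_zero, zero_add] at h3
    have h4 := (mul_eq_zero.1 h3).resolve_right (Int.cast_ne_zero.2 (hz.ne_zero τ₁))
    rw [h4, add_zero] at h2
    exact (hk.elim (fun h => h h2) fun h => h h4).elim

end CoveredPair

end

/-! ### The compression formula -/

theorem proposition2 {Γ π A B C : Type*} [Group Γ] [Group π] (T : CoveredPair Γ π A B C) (n : ℕ)
    (hX : IsRatHomologyManifold T.X T.L n)
    (o : LocalOrder T.X) (z : IntChain T.X ⊥ n) (hz : IsFundamentalCycle o T.L n z)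
    (U V : PreAbstractSimplicialComplex B) (hU : U ≤ T.Xb) (hUfin : U.faces.Finite)
    (hUV : IsRatHomologyManifold U V n)
    (zU : IntChain U ⊥ n)
    (hzU : IsFundamentalCycle (o.comap T.q (T.nondegenerate_of_le hU)) V n zU)
    (horient : ∀ s : Simplex U ⊥ n,
      zU s = z (Simplex.map T.q (T.nondegenerate_of_le hU) (fun _ _ h => h.elim) s))
    (p q : ℕ) (hpq : p + q = n) :
    Isometry (extendByZero U V T.Xb T.Lb p) ∧ Isometry (extendByZero U V T.Xb T.Lb q) ∧
    CoveredPair.finiteDuality U V hUV.le hUfin (o.comap T.q (T.nondegenerate_of_le hU)) hpq zU =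
      (ContinuousLinearMap.adjoint (extendByZero U V T.Xb T.Lb q)).toLinearMap ∘ₗ
        T.duality o hpq z ∘ₗ (extendByZero U V T.Xb T.Lb p).toLinearMap := by
  classical
  have hsub : ∀ s ∈ U.faces, s ∉ V.faces → s ∈ T.Xb.faces ∧ s ∉ T.Lb.faces := fun s hs hsV =>
    ⟨hU hs, fun h => CoveredPair.image_notMem_L hX hz hU hUfin hUV hzU horient hs hsV
      ((T.mem_Lb s).1 h).2⟩
  refine ⟨isometry_extendByZero hsub, isometry_extendByZero hsub, ?_⟩
  ext a t
  refine ((CoveredPair.ofFinite U V hUV.le hUfin).duality_apply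
    (o.comap T.q (T.nondegenerate_of_le hU)) hpq zU a t).trans ?_
  refine Eq.trans ?_ (adjoint_extendByZero_apply hsub
    (T.duality o hpq z (extendByZero U V T.Xb T.Lb p a)) t).symm
  rw [T.duality_apply]
  have hfront : ∀ σ ∈ U.faces, initialPart (T.orderB o).lt σ q = t.1 →
      (CoveredPair.ofFinite U V hUV.le hUfin).capCoeff
        (o.comap T.q (T.nondegenerate_of_le hU)) a t σ =
      T.capCoeff o (extendByZero U V T.Xb T.Lb p a) (Simplex.incl hsub t) (σ.image T.q) := by
    intro σ hσ hσt
    have h1 := (CoveredPair.ofFinite U V hUV.le hUfin).capCoeff_eq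
      (o.comap T.q (T.nondegenerate_of_le hU)) a t hσ hσt
    rw [T.capCoeff_eq o _ (Simplex.incl hsub t) (hU hσ) hσt, simplexEval_extendByZero hsub]
    refine Eq.trans ?_ h1
    congr 1
    exact Finset.image_id.symm
  -- For the trivial covering the only simplex over `σ` is `σ` itself, so a nonzero coefficient
  -- forces its front face to be `t`.
  have hex : ∀ σ : Finset B, (CoveredPair.ofFinite U V hUV.le hUfin).capCoeff
      (o.comap T.q (T.nondegenerate_of_le hU)) a t σ ≠ 0 →
      initialPart (T.orderB o).lt σ q = t.1 := by
    intro σ h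
    by_contra hne
    refine h (CoveredPair.capCoeff_of_not _ _ _ _ ?_)
    rintro ⟨τ, -, hτσ, hτt⟩
    obtain rfl : τ = σ := Finset.image_id.symm.trans hτσ
    exact hne hτt
  -- Only nonzero terms can be matched: different `n`-simplices of `U` may have the same image in
  -- `X`, but not if they share the front face `t`.
  refine Finset.sum_bij_ne_zero (fun σ _ _ =>
    Simplex.map T.q (T.nondegenerate_of_le hU) (fun _ _ h => h.elim) σ) ?_ ?_ ?_ ?_
  · intro σ _ _
    exact Finsupp.mem_support_iff.2 (hz.ne_zero _)
  · intro σ _ hσ σ' _ hσ' heq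
    have h1 := hex _ (right_ne_zero_of_mul hσ)
    have h2 := hex _ (right_ne_zero_of_mul hσ')
    exact Subtype.ext (T.eq_of_image_eq_of_subset (hU σ.2.1) (hU σ'.2.1)
      (congrArg Subtype.val heq) (U.isRelLowerSet_faces t.2.1).1
      (h1.symm.le.trans (initialPart_subset _ _ _)) (h2.symm.le.trans (initialPart_subset _ _ _)))
  · intro s _ hs
    obtain ⟨τ, hτ, hτs, hτt⟩ : ∃ τ ∈ T.Xb.faces, τ.image T.q = s.1 ∧
        initialPart (T.orderB o).lt τ q = (Simplex.incl hsub t).1 := by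
      by_contra h
      exact right_ne_zero_of_mul hs (T.capCoeff_of_not _ _ _ h)
    have hcard : τ.card = n + 1 := by
      rw [← s.2.2.1, ← hτs, Finset.card_image_of_injOn (T.covering.nondegenerate τ hτ).2]
    -- The decisive point: `τ` contains the interior simplex `t` of `U`, so it cannot leave `U`.
    have hτU : τ ∈ U.faces := CoveredPair.mem_of_subset hX hz hU hUfin hUV hzU horient t.2.1
      t.2.2.2 hτ hcard (hτt.symm.le.trans (initialPart_subset _ _ _))
    refine ⟨⟨τ, hτU, hcard, fun h => h⟩, Finsupp.mem_support_iff.2 (hzU.ne_zero _), ?_,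
      Subtype.ext hτs⟩
    refine mul_ne_zero (Int.cast_ne_zero.2 (hzU.ne_zero _)) ?_
    rw [hfront τ hτU hτt, hτs]
    exact right_ne_zero_of_mul hs
  · intro σ _ hσ
    exact congrArg₂ (· * ·) (congrArg (Int.cast : ℤ → ℂ) (horient σ))
      (hfront σ.1 σ.2.1 (hex _ (right_ne_zero_of_mul hσ)))
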